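/- Let $\mathcal C$ be a site, let $A$ be a sheaf of abelian groups on $\mathcal C$, and let $n$ be a positive integer such that the multiplication map $n_A\colon A\to A$ is surjective (an epimorphism of sheaves). Write $A[n]=\ker(n_A)$. For a sheaf of abelian groups $G$ on $\mathcal C$, let $\mathrm B G$ denote the category, fibred over $\mathcal C$, of pairs $(S,T)$ where $S$ is an object of $\mathcal C$ and $T$ is a $G$-torsor over $S$, that is, a sheaf of sets on $\mathcal C/S$ which locally has sections and carries a free and transitive action of $G|_S$; its morphisms $(S,T)\to(S',T')$ over $f\colon S\to S'$ are the $G$-equivariant maps $T\to f^*T'$ (these are automatically isomorphisms). For an $A$-torsor $T$, let $T^n$ denote its $n$-fold contraction power, the quotient sheaf of $T\times\cdots\times T$ ($n$ factors) by the relation $(t_1,\dots,t_n)\sim(a_1t_1,\dots,a_nt_n)$ for local sections $a_i$ of $A$ with $a_1\cdots a_n=1$. Let $\mathrm B_nA$ denote the category, fibred over $\mathcal C$, of triples $(S,T,\lambda)$ where $T$ is an $A$-torsor over $S$ and $\lambda$ is a global section of $T^n$ over $S$; its morphisms are the morphisms $T\to f^*T'$ of $\mathrm BA$ such that the induced map $T^n\to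 f^*T'^n$ takes $\lambda$ to $f^*\lambda'$. If $T$ is an $A[n]$-torsor over $S$, then $T^n$ has a canonical global section $\kappa$, whose restriction is $(t,\dots,t)$ for every local section $t$ of $T$. Let $T'=A\times^{A[n]}T$ be the contraction product, that is, the $A$-torsor that is the quotient sheaf of $A\times T$ by the relation $(ah,t)\sim(a,ht)$ for $h$ in $A[n]$, and let $(1,\kappa)$ be the image of $\kappa$ under the map $T^n\to T'^n$ induced by $t\mapsto(1,t)$. The natural map $$\mathrm B A[n]\to \mathrm B_nA,\qquad (S,T)\mapsto (S,\;A\times^{A[n]}T,\;(1,\kappa))$$ is a functor over $\mathcal C$. Then $\mathrm B A[n]$ and $\mathrm B_nA$ are stacks in groupoids over $\mathcal C$, and the natural map $\mathrm B A[n]\to\mathrm B_nA$ is an equivalence of stacks, i.e. it has an inverse functor over $\mathcal C$ up to natural isomorphisms over $\mathcal C$. -/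

import Mathlib

open CategoryTheory Opposite

universe w v' u' v u

namespace TorsorStack

section Sections

variable {D : Type u'} [Category.{v'} D] {K : GrothendieckTopology D}

/-- Sections of a sheaf that agree locally are equal. -/
theorem sheaf_ext {F : Dᵒᵖ ⥤ Type w} (hF : Presheaf.IsSheaf K F) {X : D}
    {s t : F.obj (op X)} {R : Sieve X} (hR : R ∈ K X)
    (h : ∀ ⦃Y : D⦄ (f : Y ⟶ X), R f → F.map f.op s = F.map f.op t) : s = t :=
  (((isSheaf_iff_isSheaf_of_type K F).1 hF).isSeparated R hR).ext h

/-- If sections with a property `P` stable under restriction are unique, and exist locally, they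
glue to a section. -/
theorem sheaf_glue {F : Dᵒᵖ ⥤ Type w} (hF : Presheaf.IsSheaf K F) {X : D}
    (P : ∀ ⦃Y : D⦄, (Y ⟶ X) → F.obj (op Y) → Prop)
    (hres : ∀ ⦃Y Z : D⦄ (f : Y ⟶ X) (g : Z ⟶ Y) (t : F.obj (op Y)),
      P f t → P (g ≫ f) (F.map g.op t))
    (huniq : ∀ ⦃Y : D⦄ (f : Y ⟶ X) (t t' : F.obj (op Y)), P f t → P f t' → t = t')
    {R : Sieve X} (hR : R ∈ K X)
    (hex : ∀ ⦃Y : D⦄ (f : Y ⟶ X), R f → ∃ t : F.obj (op Y), P f t) :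
    ∃ s : F.obj (op X), ∀ ⦃Y : D⦄ (f : Y ⟶ X) (t : F.obj (op Y)), P f t → F.map f.op s = t := by
  choose x hx using hex
  have hc : Presieve.FamilyOfElements.SieveCompatible (P := F) (fun Y f hf => x f hf) := by
    intro Y Z f g hf
    exact huniq _ _ _ (hx _ _) (hres _ _ _ (hx _ _))
  obtain ⟨s, hs, -⟩ := ((isSheaf_iff_isSheaf_of_type K F).1 hF) R hR _
    ((Presieve.compatible_iff_sieveCompatible _).2 hc)
  refine ⟨s, fun Y f t ht => ?_⟩
  refine sheaf_ext hF (K.pullback_stable f hR) fun Z g hg => ?_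
  have := hs (g ≫ f) hg
  rw [← ConcreteCategory.comp_apply, ← F.map_comp, ← op_comp, this]
  exact huniq _ _ _ (hx _ _) (hres _ _ _ ht)

end Sections

section Sheafification

variable {D : Type (max u v)} [Category.{v} D] {K : GrothendieckTopology D}

theorem sheafify_locally_mk (Q : Dᵒᵖ ⥤ Type (max u v)) {X : D}
    (s : (sheafify K Q).obj (op X)) :
    ∃ R ∈ K X, ∀ ⦃Y : D⦄ (f : Y ⟶ X), R f →
      ∃ q : Q.obj (op Y), (toSheafify K Q).app (op Y) q = (sheafify K Q).map f.op s :=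
  ⟨_, Presheaf.imageSieve_mem K (toSheafify K Q) s, fun _ _ h => by exact h⟩

theorem sheafify_locally_eq (Q : Dᵒᵖ ⥤ Type (max u v)) {X : D} {q q' : Q.obj (op X)}
    (h : (toSheafify K Q).app (op X) q = (toSheafify K Q).app (op X) q') :
    ∃ R ∈ K X, ∀ ⦃Y : D⦄ (f : Y ⟶ X), R f → Q.map f.op q = Q.map f.op q' :=
  ⟨_, Presheaf.equalizerSieve_mem K (toSheafify K Q) q q' h, fun _ _ h => by exact h⟩

end Sheafification

variable {C : Type u} [Category.{v} C] {J : GrothendieckTopology C}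


theorem isSheaf_forget (A : Sheaf J AddCommGrpCat.{max u v}) :
    Presheaf.IsSheaf J (A.obj ⋙ forget AddCommGrpCat.{max u v}) :=
  GrothendieckTopology.HasSheafCompose.isSheaf _ A.property

/-- The group of sections `A(U)`. -/
abbrev Grp (A : Sheaf J AddCommGrpCat.{max u v}) (U : C) : Type (max u v) := A.obj.obj (op U)

/-- The `n`-torsion subsheaf `A[n]`, the kernel of multiplication by `n`:
`A[n](U) = {a ∈ A(U) | n • a = 0}`. -/
def torsion (A : Sheaf J AddCommGrpCat.{max u v}) (n : ℕ) : Sheaf J AddCommGrpCat.{max u v} where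
  obj :=
    { obj := fun U => AddCommGrpCat.of (nsmulAddMonoidHom (α := A.obj.obj U) n).ker
      map := fun f => AddCommGrpCat.ofHom
        (((A.obj.map f).hom.comp (AddSubgroup.subtype _)).codRestrict _ (by
          rintro ⟨a, ha⟩
          have ha' : n • a = 0 := ha
          change n • (A.obj.map f a) = 0
          rw [← map_nsmul, ha', map_zero]))
      map_id := fun U => by
        ext ⟨a, ha⟩
        exact ConcreteCategory.congr_hom (A.obj.map_id U) a
      map_comp := fun f g => by
        ext ⟨a, ha⟩
        exact ConcreteCategory.congr_hom (A.obj.map_comp f g) a }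
  property := by
    rw [Presheaf.isSheaf_iff_isSheaf_forget J _ (forget AddCommGrpCat.{max u v}),
      isSheaf_iff_isSheaf_of_type]
    intro X R hR x hx
    have hA := (isSheaf_iff_isSheaf_of_type _ _).1 (isSheaf_forget A)
    obtain ⟨s, hs, hu⟩ := hA R hR (fun Y f hf => (x f hf).1)
      (fun Y₁ Y₂ Z g₁ g₂ f₁ f₂ h₁ h₂ e => congrArg Subtype.val (hx g₁ g₂ h₁ h₂ e))
    have h0 : n • (show Grp A X from s) = 0 := by
      refine sheaf_ext (isSheaf_forget A) hR fun Y f hf => ?_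
      change A.obj.map f.op (n • (show Grp A X from s)) = A.obj.map f.op 0
      rw [map_nsmul, map_zero]
      exact (congrArg (fun z : Grp A Y => n • z) (hs f hf)).trans (x f hf).2
    refine ⟨⟨s, h0⟩, fun Y f hf => Subtype.ext (hs f hf), fun t ht => Subtype.ext ?_⟩
    exact hu t.1 fun Y f hf => congrArg Subtype.val (ht f hf)

/-- The inclusion `A[n] → A`. -/
def torsionIncl (A : Sheaf J AddCommGrpCat.{max u v}) (n : ℕ) : torsion A n ⟶ A :=
  ObjectProperty.homMk
    { app := fun U => AddCommGrpCat.ofHom (AddSubgroup.subtype _)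
      naturality := fun U V f => by ext; rfl }

theorem nsmul_torsion (A : Sheaf J AddCommGrpCat.{max u v}) (n : ℕ) (U : C)
    (a : Grp (torsion A n) U) : n • a = 0 := Subtype.ext a.2

theorem map_eq_map_map {S : C} (F : (Over S)ᵒᵖ ⥤ Type (max u v)) {X Y Z : Over S}
    {f : Y ⟶ X} {g : Z ⟶ Y} {h : Z ⟶ X} (e : h.left = g.left ≫ f.left) (s : F.obj (op X)) :
    F.map h.op s = F.map g.op (F.map f.op s) := by
  obtain rfl : h = g ≫ f := by ext; exact e
  simp

theorem map_map_eq_map_map {S : C} (F : (Over S)ᵒᵖ ⥤ Type (max u v)) {X Y Y' Z : Over S}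
    {f : Y ⟶ X} {g : Z ⟶ Y} {f' : Y' ⟶ X} {g' : Z ⟶ Y'}
    (e : g.left ≫ f.left = g'.left ≫ f'.left) (s : F.obj (op X)) :
    F.map g.op (F.map f.op s) = F.map g'.op (F.map f'.op s) := by
  rw [← map_eq_map_map F (h := g ≫ f) (by simp), map_eq_map_map F (f := f') (g := g')]
  simpa using e

/-- The morphism from `X → S` to the terminal object `S = S` of `Over S`. -/
def toTop {S : C} (X : Over S) : X ⟶ Over.mk (𝟙 S) := Over.homMk X.hom

theorem toTop_left {S : C} (X : Over S) : (toTop X).left = X.hom := rfl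

theorem map_toTop {S : C} (F : (Over S)ᵒᵖ ⥤ Type (max u v)) {X Y : Over S} (f : Y ⟶ X)
    (s : F.obj (op (Over.mk (𝟙 S)))) :
    F.map f.op (F.map (toTop X).op s) = F.map (toTop Y).op s :=
  (map_eq_map_map F (by simp [toTop_left]) s).symm

/-- An `A`-torsor over `S`: a sheaf of sets `T` on the localised site `Over S`, with an action of
`A` restricted to `Over S`, such that `A × T → T × T`, `(a, t) ↦ (t, a + t)` is an isomorphism and
such that `T` locally has sections, i.e. `T → *` is a local epimorphism. -/
structure Torsor (A : Sheaf J AddCommGrpCat.{max u v}) (S : C) where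
  sheaf : Sheaf (J.over S) (Type (max u v))
  [act : ∀ X : Over S, AddAction (Grp A X.left) (sheaf.obj.obj (op X))]
  map_vadd : ∀ ⦃X Y : Over S⦄ (f : Y ⟶ X) (a : Grp A X.left) (t : sheaf.obj.obj (op X)),
    sheaf.obj.map f.op (a +ᵥ t) = A.obj.map f.left.op a +ᵥ sheaf.obj.map f.op t
  simply_transitive : ∀ X : Over S, Function.Bijective
    (fun p : Grp A X.left × sheaf.obj.obj (op X) => (p.2, p.1 +ᵥ p.2))
  locally_nonempty : ∀ X : Over S, ∃ R ∈ (J.over S) X, ∀ ⦃Y : Over S⦄ (f : Y ⟶ X), R f →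
    Nonempty (sheaf.obj.obj (op Y))

attribute [instance] Torsor.act

namespace Torsor

variable {A H : Sheaf J AddCommGrpCat.{max u v}} {S : C}

/-- The set of sections `T(X)`, for `X` over `S`. -/
abbrev Sec (T : Torsor A S) (X : Over S) : Type (max u v) := T.sheaf.obj.obj (op X)

theorem vadd_cancel (T : Torsor A S) {X : Over S} {a b : Grp A X.left} {t : T.Sec X}
    (h : a +ᵥ t = b +ᵥ t) : a = b :=
  congrArg Prod.fst ((T.simply_transitive X).1 (a₁ := (a, t)) (a₂ := (b, t)) (by simp [h]))

theorem exists_vadd_eq (T : Torsor A S) {X : Over S} (t t' : T.Sec X) :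
    ∃ a : Grp A X.left, a +ᵥ t = t' := by
  obtain ⟨⟨a, s⟩, h⟩ := (T.simply_transitive X).2 (t, t')
  obtain ⟨rfl, rfl⟩ := Prod.mk.inj h
  exact ⟨a, rfl⟩

/-- The relation on `n`-tuples of sections of `T` whose quotient is the `n`-fold contraction product:
`(t_i) ~ (a_i + t_i)` whenever `∑ a_i = 0`. As `A` is commutative, this is the equivalence relation
generated by `(…, a + t_i, …, t_j, …) ~ (…, t_i, …, a + t_j, …)`. -/
def powerSetoid (T : Torsor A S) (n : ℕ) (X : Over S) : Setoid (Fin n → T.Sec X) where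
  r x y := ∃ a : Fin n → Grp A X.left, ∑ i, a i = 0 ∧ y = fun i => a i +ᵥ x i
  iseqv :=
    { refl := fun x => ⟨0, by simp, by simp⟩
      symm := by
        rintro x _ ⟨a, ha, rfl⟩
        exact ⟨-a, by simp [ha], by simp⟩
      trans := by
        rintro x _ _ ⟨a, ha, rfl⟩ ⟨b, hb, rfl⟩
        exact ⟨b + a, by simp [Finset.sum_add_distrib, ha, hb], by simp [add_vadd]⟩ }

/-- The presheaf of `n`-tuples of sections of `T` modulo `powerSetoid`. -/
def powerPresheaf (T : Torsor A S) (n : ℕ) : (Over S)ᵒᵖ ⥤ Type (max u v) where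
  obj X := Quotient (T.powerSetoid n X.unop)
  map f := TypeCat.ofHom (Quotient.map (fun x i => T.sheaf.obj.map f (x i)) (by
    rintro x _ ⟨a, ha, rfl⟩
    refine ⟨fun i => A.obj.map f.unop.left.op (a i), ?_, funext fun i => T.map_vadd f.unop _ _⟩
    rw [← map_sum, ha, map_zero]))
  map_id X := by
    ext x
    induction x using Quotient.inductionOn
    exact congrArg (Quotient.mk _) (by simp)
  map_comp f g := by
    ext x
    induction x using Quotient.inductionOn
    exact congrArg (Quotient.mk _) (by simp)

/-- The `n`-th contraction power `T^n`: the quotient sheaf of `T × ⋯ × T` by the contraction relation. -/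
noncomputable def power (T : Torsor A S) (n : ℕ) : Sheaf (J.over S) (Type (max u v)) :=
  (presheafToSheaf (J.over S) (Type (max u v))).obj (T.powerPresheaf n)

/-- The section of `T^n` given by an `n`-tuple of sections of `T`. For a constant tuple `(t, …, t)`
this is the map `T → T^n`, `t ↦ t^n`. -/
noncomputable def powerMk (T : Torsor A S) (n : ℕ) {X : Over S} (x : Fin n → T.Sec X) :
    (T.power n).obj.obj (op X) :=
  (toSheafify (J.over S) (T.powerPresheaf n)).app (op X) (Quotient.mk _ x)

theorem powerMk_map (T : Torsor A S) (n : ℕ) {X Y : Over S} (f : Y ⟶ X) (x : Fin n → T.Sec X) :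
    (T.power n).obj.map f.op (T.powerMk n x) = T.powerMk n fun i => T.sheaf.obj.map f.op (x i) :=
  (NatTrans.naturality_apply (toSheafify (J.over S) (T.powerPresheaf n)) f.op
    (Quotient.mk _ x)).symm

theorem powerMk_vadd (T : Torsor A S) (n : ℕ) {X : Over S} (a : Fin n → Grp A X.left)
    (ha : ∑ i, a i = 0) (x : Fin n → T.Sec X) :
    T.powerMk n (fun i => a i +ᵥ x i) = T.powerMk n x :=
  congrArg ((toSheafify (J.over S) (T.powerPresheaf n)).app (op X))
    (Quotient.sound (s := T.powerSetoid n X) (a := x) ⟨a, ha, rfl⟩).symm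

theorem power_locally_mk (T : Torsor A S) (n : ℕ) {X : Over S} (s : (T.power n).obj.obj (op X)) :
    ∃ R ∈ (J.over S) X, ∀ ⦃Y : Over S⦄ (f : Y ⟶ X), R f →
      ∃ x : Fin n → T.Sec Y, (T.power n).obj.map f.op s = T.powerMk n x := by
  obtain ⟨R, hR, h⟩ := sheafify_locally_mk (K := J.over S) (T.powerPresheaf n) s
  refine ⟨R, hR, fun Y f hf => ?_⟩
  obtain ⟨q, hq⟩ := h f hf
  obtain ⟨x, rfl⟩ := Quotient.exists_rep q
  exact ⟨x, hq.symm⟩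

/-- A map out of `T^n` is given by a natural map on tuples that respects the contraction relation. -/
noncomputable def powerLift (T : Torsor A S) (n : ℕ) {G : (Over S)ᵒᵖ ⥤ Type (max u v)}
    (hG : Presheaf.IsSheaf (J.over S) G)
    (φ : ∀ X : Over S, (Fin n → T.Sec X) → G.obj (op X))
    (hnat : ∀ ⦃X Y : Over S⦄ (f : Y ⟶ X) (x : Fin n → T.Sec X),
      G.map f.op (φ X x) = φ Y fun i => T.sheaf.obj.map f.op (x i))
    (hinv : ∀ (X : Over S) (a : Fin n → Grp A X.left) (x : Fin n → T.Sec X), ∑ i, a i = 0 →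
      φ X (fun i => a i +ᵥ x i) = φ X x) :
    (T.power n).obj ⟶ G :=
  sheafifyLift (J.over S)
    (P := T.powerPresheaf n) (Q := G)
    { app := fun X => TypeCat.ofHom (Quotient.lift (φ X.unop) (by
        rintro x _ ⟨a, ha, rfl⟩
        exact (hinv _ a x ha).symm))
      naturality := fun X Y f => by
        ext x
        induction x using Quotient.inductionOn
        exact (hnat f.unop _).symm } hG

theorem powerLift_mk (T : Torsor A S) (n : ℕ) {G : (Over S)ᵒᵖ ⥤ Type (max u v)}
    (hG : Presheaf.IsSheaf (J.over S) G)
    (φ : ∀ X : Over S, (Fin n → T.Sec X) → G.obj (op X)) (hnat) (hinv) {X : Over S}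
    (x : Fin n → T.Sec X) :
    (T.powerLift n hG φ hnat hinv).app (op X) (T.powerMk n x) = φ X x := by
  have := ConcreteCategory.congr_hom (NatTrans.congr_app
    (toSheafify_sheafifyLift (J.over S) (P := T.powerPresheaf n) (Q := G)
      { app := fun X => TypeCat.ofHom (Quotient.lift (φ X.unop) (by
          rintro x _ ⟨a, ha, rfl⟩
          exact (hinv _ a x ha).symm))
        naturality := fun X Y f => by
          ext x
          induction x using Quotient.inductionOn
          exact (hnat f.unop _).symm } hG) (op X)) (Quotient.mk _ x)
  exact this

theorem power_hom_ext (T : Torsor A S) (n : ℕ) {G : (Over S)ᵒᵖ ⥤ Type (max u v)}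
    (hG : Presheaf.IsSheaf (J.over S) G) {α β : (T.power n).obj ⟶ G}
    (h : ∀ (X : Over S) (x : Fin n → T.Sec X),
      α.app (op X) (T.powerMk n x) = β.app (op X) (T.powerMk n x)) : α = β := by
  refine sheafify_hom_ext (J.over S) (P := T.powerPresheaf n) α β hG ?_
  ext X q
  obtain ⟨x, rfl⟩ := Quotient.exists_rep q
  exact h X.unop x

/-- If `A` is an `n`-torsion group, `T^n` has a global section that is locally `(t, …, t)` for any
local section `t` of `T`. -/
theorem exists_canonicalSection (T : Torsor A S) (n : ℕ)
    (hA : ∀ (U : C) (a : Grp A U), n • a = 0) :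
    ∃ κ : (T.power n).obj.obj (op (Over.mk (𝟙 S))),
      ∀ (X : Over S) (t : T.Sec X),
        (T.power n).obj.map (toTop X).op κ = T.powerMk n fun _ => t := by
  obtain ⟨R, hR, hne⟩ := T.locally_nonempty (Over.mk (𝟙 S))
  obtain ⟨κ, hκ⟩ := sheaf_glue (F := (T.power n).obj) (T.power n).property (X := Over.mk (𝟙 S))
    (fun Y _ s => ∃ t : T.Sec Y, s = T.powerMk n fun _ => t)
    (fun Y Z f g s h => by
      obtain ⟨t, rfl⟩ := h
      exact ⟨_, T.powerMk_map n g _⟩)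
    (fun Y f s s' h h' => by
      obtain ⟨t, rfl⟩ := h
      obtain ⟨t', rfl⟩ := h'
      obtain ⟨a, rfl⟩ := T.exists_vadd_eq t t'
      exact (T.powerMk_vadd n (fun _ => a) (by simp [hA]) _).symm)
    hR
    (fun Y f hf => ⟨_, (hne f hf).some, rfl⟩)
  exact ⟨κ, fun X t => hκ _ _ ⟨t, rfl⟩⟩

/-- The canonical global section `κ` of `T^n`, for a torsor `T` under an `n`-torsion group: the unique
one that restricts to `(t, …, t)` for every local section `t` of `T`. -/
noncomputable def canonicalSection (T : Torsor A S) (n : ℕ)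
    (hA : ∀ (U : C) (a : Grp A U), n • a = 0) : (T.power n).obj.obj (op (Over.mk (𝟙 S))) :=
  (T.exists_canonicalSection n hA).choose

theorem canonicalSection_map (T : Torsor A S) (n : ℕ)
    (hA : ∀ (U : C) (a : Grp A U), n • a = 0) {X : Over S} (t : T.Sec X) :
    (T.power n).obj.map (toTop X).op (T.canonicalSection n hA) =
      T.powerMk n fun _ => t :=
  (T.exists_canonicalSection n hA).choose_spec X t

end Torsor

/-- The objects of the classifying stack `B A`: pairs of an object `S` of the site and an `A`-torsor
over `S`. -/
structure BObj (A : Sheaf J AddCommGrpCat.{max u v}) where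
  base : C
  torsor : Torsor A base

namespace BObj

variable {A : Sheaf J AddCommGrpCat.{max u v}}

/-- A morphism of `B A` over `f : S ⟶ S'`: an `A`-equivariant map of sheaves from `T` to the pullback
of `T'` along `f` (necessarily an isomorphism). -/
structure Hom (P Q : BObj A) where
  base : P.base ⟶ Q.base
  app : ∀ X : Over P.base, P.torsor.Sec X → Q.torsor.Sec ((Over.map base).obj X)
  naturality : ∀ ⦃X Y : Over P.base⦄ (f : Y ⟶ X) (t : P.torsor.Sec X),
    app Y (P.torsor.sheaf.obj.map f.op t) =
      Q.torsor.sheaf.obj.map ((Over.map base).map f).op (app X t)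
  map_vadd : ∀ (X : Over P.base) (a : Grp A X.left) (t : P.torsor.Sec X),
    app X (a +ᵥ t) = (show Grp A ((Over.map base).obj X).left from a) +ᵥ app X t

theorem Hom.ext' {P Q : BObj A} {φ ψ : Hom P Q} (h : φ.base = ψ.base)
    (h' : ∀ (X : Over P.base) (t : P.torsor.Sec X)
      (e : (Over.map φ.base).obj X ⟶ (Over.map ψ.base).obj X), e.left = 𝟙 X.left →
      Q.torsor.sheaf.obj.map e.op (ψ.app X t) = φ.app X t) :
    φ = ψ := by
  obtain ⟨f, φ, _, _⟩ := φ
  obtain ⟨g, ψ, _, _⟩ := ψ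
  obtain rfl : f = g := h
  congr
  funext X t
  refine (h' X t (𝟙 _) rfl).symm.trans ?_
  simp

def Hom.id (P : BObj A) : Hom P P where
  base := 𝟙 P.base
  app X t := P.torsor.sheaf.obj.map
    (Over.homMk (𝟙 X.left) (by simp) : (Over.map (𝟙 P.base)).obj X ⟶ X).op t
  naturality X Y f t := map_map_eq_map_map _ (by simp) t
  map_vadd X a t := by
    refine (P.torsor.map_vadd _ a t).trans ?_
    congr 1
    exact ConcreteCategory.congr_hom (A.obj.map_id _) a

def Hom.comp {P Q R : BObj A} (φ : Hom P Q) (ψ : Hom Q R) : Hom P R where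
  base := φ.base ≫ ψ.base
  app X t := R.torsor.sheaf.obj.map
    (Over.homMk (𝟙 X.left) (by simp) : (Over.map (φ.base ≫ ψ.base)).obj X ⟶
      (Over.map ψ.base).obj ((Over.map φ.base).obj X)).op (ψ.app _ (φ.app X t))
  naturality X Y f t := by
    rw [φ.naturality, ψ.naturality]
    exact map_map_eq_map_map _ (by simp) _
  map_vadd X a t := by
    rw [φ.map_vadd, ψ.map_vadd]
    refine (R.torsor.map_vadd _ _ _).trans ?_
    congr 1
    exact ConcreteCategory.congr_hom (A.obj.map_id _) a

instance : Category (BObj A) where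
  Hom := Hom
  id := Hom.id
  comp := Hom.comp
  id_comp {P Q} φ := by
    refine Hom.ext' (Category.id_comp φ.base) fun X t e he => ?_
    refine Eq.trans ?_ (congrArg (Q.torsor.sheaf.obj.map _)
      (φ.naturality (Over.homMk (𝟙 X.left) (by simp) : (Over.map (𝟙 P.base)).obj X ⟶ X) t).symm)
    refine map_eq_map_map _ ?_ _
    simp [he]
  comp_id {P Q} φ := by
    refine Hom.ext' (Category.comp_id φ.base) fun X t e he => ?_
    refine map_eq_map_map _ ?_ _
    simp [he]
  assoc {P Q R W} φ ψ χ := by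
    refine Hom.ext' (Category.assoc φ.base ψ.base χ.base) fun X t e he => ?_
    refine Eq.trans ?_ (congrArg (W.torsor.sheaf.obj.map _) (χ.naturality
      (Over.homMk (𝟙 X.left) (by simp) : (Over.map (φ.base ≫ ψ.base)).obj X ⟶
        (Over.map ψ.base).obj ((Over.map φ.base).obj X)) (ψ.app _ (φ.app X t))).symm)
    refine (congrArg (W.torsor.sheaf.obj.map e.op) ?_).trans
      (map_map_eq_map_map (f := (Over.homMk (𝟙 X.left) (by simp) :
        (Over.map (φ.base ≫ ψ.base ≫ χ.base)).obj X ⟶ (Over.map χ.base).obj ((Over.map ψ.base).obj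
          ((Over.map φ.base).obj X)))) _ ?_ _)
    · exact (map_eq_map_map _ (by simp) _).symm
    · simp [he]

/-- The projection of `B A` to the site. -/
def proj (A : Sheaf J AddCommGrpCat.{max u v}) : BObj A ⥤ C where
  obj P := P.base
  map φ := φ.base

end BObj

namespace BObj

variable {A : Sheaf J AddCommGrpCat.{max u v}}

theorem isSheaf_pullback {S S' : C} (f : S ⟶ S') (F : Sheaf (J.over S') (Type (max u v))) :
    Presheaf.IsSheaf (J.over S) ((Over.map f).op ⋙ F.obj) :=
  ((J.overMapPullback (Type (max u v)) f).obj F).property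

/-- The map `T^n → f^*(T'^n)` induced by a morphism `T → T'` of `B A` over `f`. -/
noncomputable def powerMap {P Q : BObj A} (φ : P ⟶ Q) (n : ℕ) :
    (P.torsor.power n).obj ⟶ (Over.map (Hom.base φ)).op ⋙ (Q.torsor.power n).obj :=
  P.torsor.powerLift n (isSheaf_pullback _ _)
    (fun X x => Q.torsor.powerMk n fun i => Hom.app φ X (x i))
    (fun X Y f x => by
      refine (Q.torsor.powerMk_map n _ _).trans ?_
      exact congrArg _ (funext fun i => (Hom.naturality φ f (x i)).symm))
    (fun X a x ha => by
      simp only [Hom.map_vadd φ]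
      exact Q.torsor.powerMk_vadd n _ ha _)

theorem powerMap_mk {P Q : BObj A} (φ : P ⟶ Q) (n : ℕ) {X : Over P.base}
    (x : Fin n → P.torsor.Sec X) :
    (powerMap φ n).app (op X) (P.torsor.powerMk n x) =
      Q.torsor.powerMk n fun i => Hom.app φ X (x i) :=
  P.torsor.powerLift_mk n _ _ _ _ x

theorem powerMap_id (P : BObj A) (n : ℕ) {X : Over P.base}
    (s : (P.torsor.power n).obj.obj (op X)) :
    (powerMap (𝟙 P) n).app (op X) s = (P.torsor.power n).obj.map
      (Over.homMk (𝟙 X.left) (by simp) : (Over.map (𝟙 P.base)).obj X ⟶ X).op s := by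
  obtain ⟨R, hR, h⟩ := P.torsor.power_locally_mk n s
  refine sheaf_ext (isSheaf_pullback (𝟙 P.base) (P.torsor.power n)) hR fun Y f hf => ?_
  obtain ⟨x, hx⟩ := h f hf
  refine (NatTrans.naturality_apply (powerMap (𝟙 P) n) f.op s).symm.trans ?_
  rw [hx, powerMap_mk]
  have hx' : (P.torsor.power n).obj.map
      (Over.homMk (𝟙 Y.left) (by simp) : (Over.map (𝟙 P.base)).obj Y ⟶ Y).op
        ((P.torsor.power n).obj.map f.op s) = _ :=
    (congrArg _ hx).trans (P.torsor.powerMk_map n _ x)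
  exact hx'.symm.trans (map_map_eq_map_map _ (by simp) s)

theorem powerMap_comp {P Q R : BObj A} (φ : P ⟶ Q) (ψ : Q ⟶ R) (n : ℕ) {X : Over P.base}
    (s : (P.torsor.power n).obj.obj (op X)) :
    (powerMap (φ ≫ ψ) n).app (op X) s = (R.torsor.power n).obj.map
      (Over.homMk (𝟙 X.left) (by simp) :
        (Over.map (Hom.base φ ≫ Hom.base ψ)).obj X ⟶
          (Over.map (Hom.base ψ)).obj ((Over.map (Hom.base φ)).obj X)).op
      ((powerMap ψ n).app (op ((Over.map (Hom.base φ)).obj X)) ((powerMap φ n).app (op X) s)) := by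
  obtain ⟨T, hT, h⟩ := P.torsor.power_locally_mk n s
  refine sheaf_ext (isSheaf_pullback (Hom.base φ ≫ Hom.base ψ) (R.torsor.power n)) hT
    fun Y f hf => ?_
  obtain ⟨x, hx⟩ := h f hf
  refine (NatTrans.naturality_apply (powerMap (φ ≫ ψ) n) f.op s).symm.trans ?_
  rw [hx, powerMap_mk]
  have h1 : (Q.torsor.power n).obj.map ((Over.map (Hom.base φ)).map f).op
      ((powerMap φ n).app (op X) s) = Q.torsor.powerMk n fun i => Hom.app φ Y (x i) :=
    (NatTrans.naturality_apply (powerMap φ n) f.op s).symm.trans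
      ((congrArg _ hx).trans (powerMap_mk φ n x))
  have h2 : (R.torsor.power n).obj.map
      ((Over.map (Hom.base ψ)).map ((Over.map (Hom.base φ)).map f)).op
        ((powerMap ψ n).app (op ((Over.map (Hom.base φ)).obj X)) ((powerMap φ n).app (op X) s)) =
      R.torsor.powerMk n fun i => Hom.app ψ _ (Hom.app φ Y (x i)) :=
    (NatTrans.naturality_apply (powerMap ψ n) ((Over.map (Hom.base φ)).map f).op _).symm.trans
      ((congrArg _ h1).trans (powerMap_mk ψ n _))
  have h3 := (congrArg ((R.torsor.power n).obj.map (Over.homMk (𝟙 Y.left) (by simp) :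
        (Over.map (Hom.base φ ≫ Hom.base ψ)).obj Y ⟶
          (Over.map (Hom.base ψ)).obj ((Over.map (Hom.base φ)).obj Y)).op) h2).trans
    (R.torsor.powerMk_map n _ _)
  exact h3.symm.trans (map_map_eq_map_map _ (by simp) _)

end BObj

/-- The objects of `B_n A`: an `A`-torsor `T` over an object `S` of the site, and a global section of
`T^n`, i.e. a section over the terminal object of `Over S`. -/
structure BPowObj (A : Sheaf J AddCommGrpCat.{max u v}) (n : ℕ) extends BObj A where
  sec : (torsor.power n).obj.obj (op (Over.mk (𝟙 base)))

namespace BPowObj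

variable {A : Sheaf J AddCommGrpCat.{max u v}} {n : ℕ}

/-- A morphism `T → T'` of `B A` over `f : S ⟶ S'` is compatible with given global sections of `T^n`
and `T'^n`: the induced map `T^n → f^*(T'^n)` takes the first to the pullback of the second. -/
def PreservesSec {P Q : BPowObj A n} (φ : P.toBObj ⟶ Q.toBObj) : Prop :=
  (BObj.powerMap φ n).app (op (Over.mk (𝟙 P.base))) P.sec =
    (Q.torsor.power n).obj.map
      (toTop ((Over.map (BObj.Hom.base φ)).obj (Over.mk (𝟙 P.base)))).op Q.sec

theorem PreservesSec.id (P : BPowObj A n) : PreservesSec (P := P) (Q := P) (𝟙 P.toBObj) := by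
  refine (BObj.powerMap_id _ _ _).trans ?_
  refine congrArg (fun f => (P.torsor.power n).obj.map (Quiver.Hom.op f) P.sec) ?_
  ext
  exact (Category.id_comp (𝟙 P.base)).symm

theorem PreservesSec.comp {P Q R : BPowObj A n} {φ : P.toBObj ⟶ Q.toBObj}
    {ψ : Q.toBObj ⟶ R.toBObj} (h : PreservesSec φ) (h' : PreservesSec ψ) :
    PreservesSec (P := P) (Q := R) (φ ≫ ψ) := by
  refine (BObj.powerMap_comp φ ψ n _).trans ?_
  have h1 : (BObj.powerMap ψ n).app (op ((Over.map (BObj.Hom.base φ)).obj (Over.mk (𝟙 P.base))))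
      ((BObj.powerMap φ n).app (op (Over.mk (𝟙 P.base))) P.sec) = (R.torsor.power n).obj.map
      (toTop ((Over.map (BObj.Hom.base ψ)).obj ((Over.map (BObj.Hom.base φ)).obj
        (Over.mk (𝟙 P.base))))).op R.sec := by
    refine (congrArg _ h).trans ((NatTrans.naturality_apply (BObj.powerMap ψ n) _ Q.sec).trans
      ((congrArg (fun z => ((Over.map (BObj.Hom.base ψ)).op ⋙ (R.torsor.power n).obj).map
        (toTop ((Over.map (BObj.Hom.base φ)).obj (Over.mk (𝟙 P.base)))).op z) h').trans ?_))
    exact map_toTop (R.torsor.power n).obj _ _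
  exact (congrArg _ h1).trans (map_toTop (R.torsor.power n).obj _ _)

/-- Morphisms of `B_n A`: morphisms of torsors respecting the global sections. -/
@[ext]
structure Hom (P Q : BPowObj A n) where
  hom : P.toBObj ⟶ Q.toBObj
  preservesSec : PreservesSec hom

instance : Category (BPowObj A n) where
  Hom := Hom
  id P := ⟨𝟙 P.toBObj, .id P⟩
  comp φ ψ := ⟨φ.hom ≫ ψ.hom, φ.preservesSec.comp ψ.preservesSec⟩

/-- The projection of `B_n A` to the site. -/
def proj (A : Sheaf J AddCommGrpCat.{max u v}) (n : ℕ) : BPowObj A n ⥤ C where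
  obj P := P.base
  map φ := BObj.Hom.base (Hom.hom φ)

end BPowObj


namespace Torsor

variable {A H : Sheaf J AddCommGrpCat.{max u v}} {S : C} (i : H ⟶ A) (T : Torsor H S)

/-- The homomorphism `H(U) → A(U)` on sections given by `i : H ⟶ A`. -/
abbrev grpMap {A H : Sheaf J AddCommGrpCat.{max u v}} (i : H ⟶ A) {U : C} (h : Grp H U) : Grp A U :=
  i.hom.app (op U) h

theorem grpMap_map {A H : Sheaf J AddCommGrpCat.{max u v}} (i : H ⟶ A) {U V : C} (f : V ⟶ U)
    (h : Grp H U) : A.obj.map f.op (grpMap i h) = grpMap i (H.obj.map f.op h) :=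
  (NatTrans.naturality_apply i.hom f.op h).symm

/-- The contraction relation `(a + i h, t) ~ (a, h + t)` on `A × T`, for `h` in `H`. -/
def contractSetoid (X : Over S) : Setoid (Grp A X.left × T.Sec X) where
  r p q := ∃ h : Grp H X.left, p.1 = q.1 + grpMap i h ∧ q.2 = h +ᵥ p.2
  iseqv :=
    { refl := fun p => ⟨0, by simp, by simp⟩
      symm := by
        rintro ⟨a, t⟩ ⟨b, s⟩ ⟨h, h1, h2⟩
        dsimp only at h1 h2
        exact ⟨-h, by simp [h1], by simp [h2]⟩
      trans := by
        rintro ⟨a, t⟩ ⟨b, s⟩ ⟨c, r⟩ ⟨h, h1, h2⟩ ⟨k, h3, h4⟩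
        dsimp only at h1 h2 h3 h4
        exact ⟨k + h, by simp [h1, h3, add_assoc], by simp [h2, h4, add_vadd]⟩ }

/-- The presheaf quotient of `A × T` by the contraction relation. -/
def contractPresheaf : (Over S)ᵒᵖ ⥤ Type (max u v) where
  obj X := Quotient (contractSetoid i T X.unop)
  map f := TypeCat.ofHom (Quotient.map
    (fun p => (A.obj.map f.unop.left.op p.1, T.sheaf.obj.map f p.2)) (by
      rintro ⟨a, t⟩ ⟨b, s⟩ ⟨h, h1, h2⟩
      refine ⟨H.obj.map f.unop.left.op h, ?_,
        (congrArg (T.sheaf.obj.map f) h2).trans (T.map_vadd f.unop h t)⟩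
      rw [← grpMap_map, ← map_add]
      exact congrArg _ h1))
  map_id X := by
    ext x
    induction x using Quotient.inductionOn
    exact congrArg (Quotient.mk _) (by simp)
  map_comp f g := by
    ext x
    induction x using Quotient.inductionOn
    exact congrArg (Quotient.mk _) (by simp)

/-- The sheaf of sets underlying the contraction product of `A` and `T` over `H`. -/
noncomputable def contractSheaf : Sheaf (J.over S) (Type (max u v)) :=
  (presheafToSheaf (J.over S) (Type (max u v))).obj (contractPresheaf i T)

/-- The section `(a, t)` of the contraction product. -/
noncomputable def contractMk {X : Over S} (a : Grp A X.left) (t : T.Sec X) :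
    (contractSheaf i T).obj.obj (op X) :=
  (toSheafify (J.over S) (contractPresheaf i T)).app (op X) (Quotient.mk _ (a, t))

theorem contractMk_map {X Y : Over S} (f : Y ⟶ X) (a : Grp A X.left) (t : T.Sec X) :
    (contractSheaf i T).obj.map f.op (contractMk i T a t) =
      contractMk i T (A.obj.map f.left.op a) (T.sheaf.obj.map f.op t) :=
  (NatTrans.naturality_apply (toSheafify (J.over S) (contractPresheaf i T)) f.op
    (Quotient.mk _ (a, t))).symm

theorem contractMk_rel {X : Over S} (a : Grp A X.left) (h : Grp H X.left) (t : T.Sec X) :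
    contractMk i T (a + grpMap i h) t = contractMk i T a (h +ᵥ t) :=
  congrArg ((toSheafify (J.over S) (contractPresheaf i T)).app (op X))
    (Quotient.sound (s := contractSetoid i T X) ⟨h, rfl, rfl⟩)

theorem contract_locally_mk {X : Over S} (s : (contractSheaf i T).obj.obj (op X)) :
    ∃ R ∈ (J.over S) X, ∀ ⦃Y : Over S⦄ (f : Y ⟶ X), R f →
      ∃ (a : Grp A Y.left) (t : T.Sec Y),
        (contractSheaf i T).obj.map f.op s = contractMk i T a t := by
  obtain ⟨R, hR, h⟩ := sheafify_locally_mk (K := J.over S) (contractPresheaf i T) s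
  refine ⟨R, hR, fun Y f hf => ?_⟩
  obtain ⟨q, hq⟩ := h f hf
  obtain ⟨⟨a, t⟩, rfl⟩ := Quotient.exists_rep q
  exact ⟨a, t, hq.symm⟩

theorem contract_locally_eq {X : Over S} {a b : Grp A X.left} {t r : T.Sec X}
    (e : contractMk i T a t = contractMk i T b r) :
    ∃ R ∈ (J.over S) X, ∀ ⦃Y : Over S⦄ (f : Y ⟶ X), R f → ∃ h : Grp H Y.left,
      A.obj.map f.left.op a = A.obj.map f.left.op b + grpMap i h ∧
        T.sheaf.obj.map f.op r = h +ᵥ T.sheaf.obj.map f.op t := by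
  obtain ⟨R, hR, h⟩ := sheafify_locally_eq (K := J.over S) (contractPresheaf i T) e
  exact ⟨R, hR, fun Y f hf => Quotient.exact (s := contractSetoid i T Y) (h f hf)⟩

theorem contractMk_vadd_congr {X : Over S} (c : Grp A X.left) {a b : Grp A X.left} {t r : T.Sec X}
    (e : contractMk i T a t = contractMk i T b r) :
    contractMk i T (c + a) t = contractMk i T (c + b) r := by
  obtain ⟨R, hR, h⟩ := contract_locally_eq i T e
  refine sheaf_ext (contractSheaf i T).property hR fun Y f hf => ?_
  obtain ⟨h, h1, h2⟩ := h f hf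
  refine (contractMk_map i T f _ _).trans (Eq.trans ?_ (contractMk_map i T f _ _).symm)
  rw [map_add, map_add, h1, h2, ← add_assoc, contractMk_rel]

theorem grp_ext {X : Over S} {R : Sieve X} (hR : R ∈ (J.over S) X) {a b : Grp A X.left}
    (h : ∀ ⦃Y : Over S⦄ (f : Y ⟶ X), R f → A.obj.map f.left.op a = A.obj.map f.left.op b) :
    a = b :=
  sheaf_ext (F := (Over.forget S).op ⋙ A.obj ⋙ forget AddCommGrpCat.{max u v})
    ((J.overPullback (Type (max u v)) S).obj ⟨_, isSheaf_forget A⟩).property hR h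

theorem contractMk_cancel {X : Over S} {a b : Grp A X.left} {t : T.Sec X}
    (e : contractMk i T a t = contractMk i T b t) : a = b := by
  obtain ⟨R, hR, h⟩ := contract_locally_eq i T e
  refine grp_ext hR fun Y f hf => ?_
  obtain ⟨h, h1, h2⟩ := h f hf
  have h0 : h = 0 := T.vadd_cancel (h2.symm.trans (zero_vadd _ _).symm)
  simpa [h0] using h1

theorem exists_contractVadd {X : Over S} (c : Grp A X.left)
    (s : (contractSheaf i T).obj.obj (op X)) :
    ∃ r : (contractSheaf i T).obj.obj (op X), ∀ ⦃Y : Over S⦄ (f : Y ⟶ X) (a : Grp A Y.left)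
      (t : T.Sec Y), (contractSheaf i T).obj.map f.op s = contractMk i T a t →
        (contractSheaf i T).obj.map f.op r = contractMk i T (A.obj.map f.left.op c + a) t := by
  obtain ⟨R, hR, h⟩ := contract_locally_mk i T s
  obtain ⟨r, hr⟩ := sheaf_glue (F := (contractSheaf i T).obj) (contractSheaf i T).property (X := X)
    (fun Y f r => ∃ (a : Grp A Y.left) (t : T.Sec Y),
      (contractSheaf i T).obj.map f.op s = contractMk i T a t ∧
        r = contractMk i T (A.obj.map f.left.op c + a) t)
    (fun Y Z f g r h => by
      obtain ⟨a, t, h1, rfl⟩ := h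
      refine ⟨A.obj.map g.left.op a, T.sheaf.obj.map g.op t, ?_, ?_⟩
      · rw [← contractMk_map, ← h1]
        simp
      · rw [contractMk_map, map_add]
        simp)
    (fun Y f r r' h h' => by
      obtain ⟨a, t, h1, rfl⟩ := h
      obtain ⟨b, u, h2, rfl⟩ := h'
      exact contractMk_vadd_congr i T _ (h1.symm.trans h2))
    hR
    (fun Y f hf => by
      obtain ⟨a, t, h1⟩ := h f hf
      exact ⟨_, a, t, h1, rfl⟩)
  exact ⟨r, fun Y f a t h => hr f _ ⟨a, t, h, rfl⟩⟩

/-- The action of `A` on the contraction product: locally `c + (a, t) = (c + a, t)`,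
see `contractVadd_mk`. -/
noncomputable def contractVadd {X : Over S} (c : Grp A X.left)
    (s : (contractSheaf i T).obj.obj (op X)) : (contractSheaf i T).obj.obj (op X) :=
  (exists_contractVadd i T c s).choose

theorem contractVadd_mk {X : Over S} (c a : Grp A X.left) (t : T.Sec X) :
    contractVadd i T c (contractMk i T a t) = contractMk i T (c + a) t := by
  have := (exists_contractVadd i T c (contractMk i T a t)).choose_spec (𝟙 X) a t (by simp)
  simpa [contractVadd] using this

theorem contractVadd_map {X Y : Over S} (f : Y ⟶ X) (c : Grp A X.left)
    (s : (contractSheaf i T).obj.obj (op X)) :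
    (contractSheaf i T).obj.map f.op (contractVadd i T c s) =
      contractVadd i T (A.obj.map f.left.op c) ((contractSheaf i T).obj.map f.op s) := by
  obtain ⟨R, hR, h⟩ := contract_locally_mk i T ((contractSheaf i T).obj.map f.op s)
  refine sheaf_ext (contractSheaf i T).property hR fun Z g hg => ?_
  obtain ⟨a, t, e⟩ := h g hg
  have h1 := (exists_contractVadd i T c s).choose_spec (g ≫ f) a t (by simpa using e)
  have h2 := (exists_contractVadd i T (A.obj.map f.left.op c)
    ((contractSheaf i T).obj.map f.op s)).choose_spec g a t e
  refine Eq.trans ?_ (h1.trans (Eq.trans ?_ h2.symm))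
  · simp [contractVadd]
  · simp

theorem contract_induction {X : Over S} {s r : (contractSheaf i T).obj.obj (op X)}
    (h : ∀ ⦃Y : Over S⦄ (f : Y ⟶ X) (a : Grp A Y.left) (t : T.Sec Y),
      (contractSheaf i T).obj.map f.op s = contractMk i T a t →
        (contractSheaf i T).obj.map f.op r = contractMk i T a t) : s = r := by
  obtain ⟨R, hR, h'⟩ := contract_locally_mk i T s
  refine sheaf_ext (contractSheaf i T).property hR fun Y f hf => ?_
  obtain ⟨a, t, e⟩ := h' f hf
  exact e.trans (h f a t e).symm

theorem contractVadd_cancel {X : Over S} {c d : Grp A X.left}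
    {s : (contractSheaf i T).obj.obj (op X)}
    (h : contractVadd i T c s = contractVadd i T d s) : c = d := by
  obtain ⟨R, hR, h'⟩ := contract_locally_mk i T s
  refine grp_ext hR fun Y f hf => ?_
  obtain ⟨a, t, e⟩ := h' f hf
  have h3 := congrArg ((contractSheaf i T).obj.map f.op) h
  have h4 := (contractVadd_map i T f c s).symm.trans (h3.trans (contractVadd_map i T f d s))
  rw [e, contractVadd_mk, contractVadd_mk] at h4
  exact add_right_cancel (contractMk_cancel i T h4)

theorem exists_contractVadd_eq {X : Over S} (s r : (contractSheaf i T).obj.obj (op X)) :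
    ∃ c : Grp A X.left, contractVadd i T c s = r := by
  obtain ⟨R, hR, h⟩ := contract_locally_mk i T s
  obtain ⟨R', hR', h'⟩ := contract_locally_mk i T r
  have hex : ∀ ⦃Y : Over S⦄ (f : Y ⟶ X), (R ⊓ R') f → ∃ c : Grp A Y.left,
      contractVadd i T c ((contractSheaf i T).obj.map f.op s) =
        (contractSheaf i T).obj.map f.op r := by
    rintro Y f ⟨hf, hf'⟩
    obtain ⟨a, t, e⟩ := h f hf
    obtain ⟨b, u, e'⟩ := h' f hf'
    obtain ⟨k, rfl⟩ := T.exists_vadd_eq t u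
    refine ⟨b + grpMap i k - a, ?_⟩
    rw [e, e', contractVadd_mk, sub_add_cancel, contractMk_rel]
  have hRR := (J.over S).intersection_covering hR hR'
  obtain ⟨c, hc⟩ := sheaf_glue (F := (Over.forget S).op ⋙ A.obj ⋙ forget AddCommGrpCat.{max u v})
    ((J.overPullback (Type (max u v)) S).obj ⟨_, isSheaf_forget A⟩).property (X := X)
    (fun Y f c => contractVadd i T (show Grp A Y.left from c)
      ((contractSheaf i T).obj.map f.op s) = (contractSheaf i T).obj.map f.op r)
    (fun Y Z f g c h => by
      have h1 := (contractVadd_map i T g c _).symm.trans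
        (congrArg ((contractSheaf i T).obj.map g.op) h)
      have h2 : contractVadd i T (A.obj.map g.left.op (show Grp A Y.left from c))
          ((contractSheaf i T).obj.map (g ≫ f).op s) =
            (contractSheaf i T).obj.map (g ≫ f).op r := by
        simpa using h1
      exact h2)
    (fun Y f c c' h h' => contractVadd_cancel i T (h.trans h'.symm))
    hRR hex
  refine ⟨c, sheaf_ext (contractSheaf i T).property hRR fun Y f hf => ?_⟩
  obtain ⟨d, hd⟩ := hex f hf
  refine (contractVadd_map i T f c s).trans (Eq.trans ?_ hd)
  exact congrArg (fun d => contractVadd i T d _) (hc f d hd)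

/-- The contraction product of `A` with an `H`-torsor `T` along `i : H ⟶ A`, as an `A`-torsor. -/
noncomputable def contract : Torsor A S where
  sheaf := contractSheaf i T
  act X :=
    { vadd := contractVadd i T
      zero_vadd := fun s => (contract_induction i T fun Y f a t e => by
        refine (contractVadd_map i T f _ _).trans ?_
        rw [e, contractVadd_mk, map_zero, zero_add]).symm
      add_vadd := fun c d s => by
        obtain ⟨R, hR, h⟩ := contract_locally_mk i T s
        refine sheaf_ext (contractSheaf i T).property hR fun Y f hf => ?_
        obtain ⟨a, t, e⟩ := h f hf
        change _ = (contractSheaf i T).obj.map f.op (contractVadd i T c (contractVadd i T d s))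
        refine (contractVadd_map i T f _ _).trans ?_
        rw [contractVadd_map, contractVadd_map, e, contractVadd_mk, contractVadd_mk,
          contractVadd_mk, map_add, add_assoc] }
  map_vadd X Y f a s := contractVadd_map i T f a s
  simply_transitive X := by
    constructor
    · rintro ⟨c, s⟩ ⟨d, r⟩ h
      obtain ⟨rfl, h2⟩ := Prod.mk.inj h
      exact Prod.ext (contractVadd_cancel i T h2) rfl
    · rintro ⟨s, r⟩
      obtain ⟨c, rfl⟩ := exists_contractVadd_eq i T s r
      exact ⟨(c, s), rfl⟩
  locally_nonempty X := by
    obtain ⟨R, hR, h⟩ := T.locally_nonempty X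
    exact ⟨R, hR, fun Y f hf => ⟨contractMk i T 0 (h f hf).some⟩⟩

theorem contractMk_eq_vadd {X : Over S} (a : Grp A X.left) (t : T.Sec X) :
    contractMk i T a t = a +ᵥ (show (contract i T).Sec X from contractMk i T 0 t) := by
  refine Eq.trans ?_ (contractVadd_mk i T a 0 t).symm
  rw [add_zero]

theorem contractMk_zero_vadd {X : Over S} (h : Grp H X.left) (t : T.Sec X) :
    contractMk i T 0 (h +ᵥ t) =
      grpMap i h +ᵥ (show (contract i T).Sec X from contractMk i T 0 t) := by
  rw [← contractMk_rel, zero_add]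
  exact contractMk_eq_vadd i T _ t

theorem contract_ext {G : (Over S)ᵒᵖ ⥤ Type (max u v)} (hG : Presheaf.IsSheaf (J.over S) G)
    {X : Over S} {s r : G.obj (op X)} (z : (contract i T).Sec X)
    (h : ∀ ⦃Y : Over S⦄ (f : Y ⟶ X) (a : Grp A Y.left) (t : T.Sec Y),
      (contract i T).sheaf.obj.map f.op z = contractMk i T a t → G.map f.op s = G.map f.op r) :
    s = r := by
  obtain ⟨R, hR, h'⟩ := contract_locally_mk i T z
  refine sheaf_ext hG hR fun Y f hf => ?_
  obtain ⟨a, t, e⟩ := h' f hf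
  exact h f a t e

end Torsor

namespace BObj

variable {A H : Sheaf J AddCommGrpCat.{max u v}} (i : H ⟶ A)

open TorsorStack.Torsor

noncomputable def inducedObj (P : BObj H) : BObj A := ⟨P.base, contract i P.torsor⟩

section Lift

variable {P : BObj H} {Q : BObj A} (f : P.base ⟶ Q.base)
  (φ : ∀ X : Over P.base, P.torsor.Sec X → Q.torsor.Sec ((Over.map f).obj X))
  (hnat : ∀ ⦃X Y : Over P.base⦄ (g : Y ⟶ X) (t : P.torsor.Sec X),
    φ Y (P.torsor.sheaf.obj.map g.op t) =
      Q.torsor.sheaf.obj.map ((Over.map f).map g).op (φ X t))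
  (hequiv : ∀ (X : Over P.base) (h : Grp H X.left) (t : P.torsor.Sec X),
    φ X (h +ᵥ t) = (show Grp A ((Over.map f).obj X).left from grpMap i h) +ᵥ φ X t)

noncomputable def liftNatTrans :
    (contractSheaf i P.torsor).obj ⟶ (Over.map f).op ⋙ Q.torsor.sheaf.obj :=
  sheafifyLift (J.over P.base) (P := contractPresheaf i P.torsor)
    (Q := (Over.map f).op ⋙ Q.torsor.sheaf.obj)
    { app := fun X => TypeCat.ofHom (Quotient.lift
        (fun p => (show Grp A ((Over.map f).obj X.unop).left from p.1) +ᵥ φ X.unop p.2) (by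
          rintro ⟨a, t⟩ ⟨b, s⟩ ⟨h, h1, h2⟩
          dsimp only at h1 h2 ⊢
          rw [h1, h2, hequiv]
          exact add_vadd (show Grp A ((Over.map f).obj X.unop).left from b) (grpMap i h)
            (φ X.unop t)))
      naturality := fun X Y g => by
        ext x
        induction x using Quotient.inductionOn with
        | _ p =>
          refine Eq.trans ?_ (Q.torsor.map_vadd ((Over.map f).map g.unop) _ _).symm
          exact congrArg _ (hnat g.unop p.2) }
    (isSheaf_pullback f Q.torsor.sheaf)

theorem liftNatTrans_mk {X : Over P.base} (a : Grp A X.left) (t : P.torsor.Sec X) :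
    (liftNatTrans i f φ hnat hequiv).app (op X) (contractMk i P.torsor a t) =
      (show Grp A ((Over.map f).obj X).left from a) +ᵥ φ X t :=
  ConcreteCategory.congr_hom (NatTrans.congr_app
    (toSheafify_sheafifyLift (J.over P.base) (P := contractPresheaf i P.torsor)
      (Q := (Over.map f).op ⋙ Q.torsor.sheaf.obj) _
      (isSheaf_pullback f Q.torsor.sheaf)) (op X)) (Quotient.mk _ (a, t))

/-- An `H`-equivariant map from `T` to (a pullback of) an `A`-torsor extends to the contraction
product. -/
noncomputable def lift : inducedObj i P ⟶ Q where
  base := f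
  app X s := (liftNatTrans i f φ hnat hequiv).app (op X) s
  naturality X Y g s := NatTrans.naturality_apply (liftNatTrans i f φ hnat hequiv) g.op s
  map_vadd X c s := by
    refine contract_ext i P.torsor (isSheaf_pullback f Q.torsor.sheaf) s fun Y g a t e => ?_
    refine (NatTrans.naturality_apply (liftNatTrans i f φ hnat hequiv) g.op _).symm.trans ?_
    refine Eq.trans ?_ (Q.torsor.map_vadd ((Over.map f).map g) _ _).symm
    have h1 : (contractSheaf i P.torsor).obj.map g.op (contractVadd i P.torsor c s) =
        contractMk i P.torsor (A.obj.map g.left.op c + a) t :=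
      (contractVadd_map i P.torsor g c s).trans
        ((congrArg _ e).trans (contractVadd_mk i P.torsor _ a t))
    refine (congrArg _ h1).trans ((liftNatTrans_mk i f φ hnat hequiv _ _).trans ?_)
    have h2 := (NatTrans.naturality_apply (liftNatTrans i f φ hnat hequiv) g.op s).symm.trans
      ((congrArg _ e).trans (liftNatTrans_mk i f φ hnat hequiv a t))
    exact (add_vadd (show Grp A ((Over.map f).obj Y).left from A.obj.map g.left.op c)
      (show Grp A ((Over.map f).obj Y).left from a) (φ Y t)).trans (congrArg _ h2.symm)

theorem lift_app_mk {X : Over P.base} (t : P.torsor.Sec X) :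
    Hom.app (lift i f φ hnat hequiv) X (contractMk i P.torsor 0 t) = φ X t :=
  (liftNatTrans_mk i f φ hnat hequiv 0 t).trans
    (zero_vadd (Grp A ((Over.map f).obj X).left) (φ X t))

end Lift

theorem induced_hom_ext {P : BObj H} {Q : BObj A} {φ ψ : inducedObj i P ⟶ Q}
    (hb : Hom.base φ = Hom.base ψ)
    (h : ∀ (X : Over P.base) (t : P.torsor.Sec X)
      (e : (Over.map (Hom.base φ)).obj X ⟶ (Over.map (Hom.base ψ)).obj X), e.left = 𝟙 X.left →
      Q.torsor.sheaf.obj.map e.op (Hom.app ψ X (contractMk i P.torsor 0 t)) =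
        Hom.app φ X (contractMk i P.torsor 0 t)) : φ = ψ := by
  refine Hom.ext' hb fun X s e he => ?_
  refine contract_ext i P.torsor (isSheaf_pullback (Hom.base φ) Q.torsor.sheaf) s
    fun Y g a t e' => ?_
  have hY : ((Over.map (Hom.base φ)).obj Y).hom = ((Over.map (Hom.base ψ)).obj Y).hom := by
    exact congrArg (fun z => Y.hom ≫ z) hb
  let eY : (Over.map (Hom.base φ)).obj Y ⟶ (Over.map (Hom.base ψ)).obj Y :=
    Over.homMk (𝟙 Y.left) ((Category.id_comp _).trans hY.symm)
  have h1 : Q.torsor.sheaf.obj.map ((Over.map (Hom.base φ)).map g).op (Hom.app φ X s) =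
      Hom.app φ Y (contractMk i P.torsor a t) :=
    (Hom.naturality φ g s).symm.trans (congrArg _ e')
  have h2 : Q.torsor.sheaf.obj.map ((Over.map (Hom.base ψ)).map g).op (Hom.app ψ X s) =
      Hom.app ψ Y (contractMk i P.torsor a t) :=
    (Hom.naturality ψ g s).symm.trans (congrArg _ e')
  refine Eq.trans ?_ h1.symm
  refine (map_map_eq_map_map Q.torsor.sheaf.obj (g' := eY)
    (f' := (Over.map (Hom.base ψ)).map g) (by
      simp only [eY, he, Over.homMk_left]
      exact (Category.comp_id _).trans (Category.id_comp _).symm) _).trans ?_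
  rw [h2, contractMk_eq_vadd]
  refine (congrArg (Q.torsor.sheaf.obj.map eY.op) (Hom.map_vadd ψ Y a _)).trans ?_
  refine Eq.trans ?_ (Hom.map_vadd φ Y a _).symm
  refine (Q.torsor.map_vadd eY _ _).trans ?_
  rw [h Y t eY rfl]
  congr 1
  exact ConcreteCategory.congr_hom (A.obj.map_id _) a

/-- On morphisms, locally `(a, t) ↦ (a, φ t)`. -/
noncomputable def inducedMap {P Q : BObj H} (φ : P ⟶ Q) : inducedObj i P ⟶ inducedObj i Q :=
  lift i (Q := inducedObj i Q) (Hom.base φ)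
    (fun X t => contractMk i Q.torsor (X := (Over.map (Hom.base φ)).obj X) 0 (Hom.app φ X t))
    (fun X Y g t => by
      refine Eq.trans ?_ (contractMk_map i Q.torsor _ _ _).symm
      rw [map_zero, Hom.naturality φ]
      rfl)
    (fun X h t => by
      rw [Hom.map_vadd φ]
      exact contractMk_zero_vadd i Q.torsor _ _)

theorem inducedMap_app_mk {P Q : BObj H} (φ : P ⟶ Q) {X : Over P.base} (t : P.torsor.Sec X) :
    Hom.app (inducedMap i φ) X (contractMk i P.torsor 0 t) =
      contractMk i Q.torsor (X := (Over.map (Hom.base φ)).obj X) 0 (Hom.app φ X t) :=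
  lift_app_mk i _ _ _ _ t

/-- The functor `B H → B A` induced by `i : H ⟶ A`, taking `T` to its contraction product with `A`. -/
noncomputable def induced : BObj H ⥤ BObj A where
  obj := inducedObj i
  map := inducedMap i
  map_id P := by
    refine induced_hom_ext i rfl fun X t e he => ?_
    refine Eq.trans ?_ (inducedMap_app_mk i (𝟙 P) t).symm
    refine (congrArg ((contractSheaf i P.torsor).obj.map e.op)
      (contractMk_map i P.torsor _ 0 t)).trans ((contractMk_map i P.torsor e _ _).trans ?_)
    rw [map_zero, map_zero]
    exact congrArg _ (map_eq_map_map P.torsor.sheaf.obj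
      (by exact (Category.id_comp (𝟙 X.left)).symm.trans (congrArg (fun z => z ≫ _) he).symm) _).symm
  map_comp {P Q R} φ ψ := by
    refine induced_hom_ext i rfl fun X t e he => ?_
    refine Eq.trans ?_ (inducedMap_app_mk i (φ ≫ ψ) t).symm
    have h1 : Hom.app (inducedMap i ψ) _ (Hom.app (inducedMap i φ) X
        (contractMk i P.torsor 0 t)) = contractMk i R.torsor
          (X := (Over.map (Hom.base ψ)).obj ((Over.map (Hom.base φ)).obj X)) 0
            (Hom.app ψ _ (Hom.app φ X t)) :=
      (congrArg _ (inducedMap_app_mk i φ t)).trans (inducedMap_app_mk i ψ _)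
    refine (congrArg (fun z => (contractSheaf i R.torsor).obj.map e.op
      ((contractSheaf i R.torsor).obj.map (Quiver.Hom.op _) z)) h1).trans ?_
    refine (congrArg ((contractSheaf i R.torsor).obj.map e.op)
      (contractMk_map i R.torsor _ 0 _)).trans ((contractMk_map i R.torsor e _ _).trans ?_)
    rw [map_zero, map_zero]
    exact congrArg _ (map_eq_map_map R.torsor.sheaf.obj
      (by exact (Category.id_comp (𝟙 X.left)).symm.trans (congrArg (fun z => z ≫ _) he).symm) _).symm

end BObj

namespace Torsor

variable {A H : Sheaf J AddCommGrpCat.{max u v}} {S : C} (i : H ⟶ A) (T : Torsor H S) (n : ℕ)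

/-- The map from `T^n` to the `n`-th power of the contraction product, induced by `t ↦ (0, t)`. -/
noncomputable def powerContract : (T.power n).obj ⟶ ((contract i T).power n).obj :=
  T.powerLift n ((contract i T).power n).property
    (fun _ x => (contract i T).powerMk n fun j => contractMk i T 0 (x j))
    (fun X Y f x => by
      refine ((contract i T).powerMk_map n f _).trans ?_
      refine congrArg _ (funext fun j => (contractMk_map i T f 0 (x j)).trans ?_)
      rw [map_zero])
    (fun X a x ha => by
      refine (congrArg _ (funext fun j => contractMk_zero_vadd i T (a j) (x j))).trans
        ((contract i T).powerMk_vadd n (fun j => grpMap i (a j)) ?_ _)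
      rw [← map_sum, ha, map_zero])

theorem powerContract_mk {X : Over S} (x : Fin n → T.Sec X) :
    (powerContract i T n).app (op X) (T.powerMk n x) =
      (contract i T).powerMk n fun j => contractMk i T 0 (x j) :=
  T.powerLift_mk n _ _ _ _ x

/-- The global section of the `n`-th power of the contraction product that is induced by the canonical
section of `T^n`. Locally it is `((0, t), …, (0, t))`, see `contractSection_map`. -/
noncomputable def contractSection (hH : ∀ (U : C) (a : Grp H U), n • a = 0) :
    ((contract i T).power n).obj.obj (op (Over.mk (𝟙 S))) :=
  (powerContract i T n).app (op (Over.mk (𝟙 S))) (T.canonicalSection n hH)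

theorem contractSection_map (hH : ∀ (U : C) (a : Grp H U), n • a = 0) {X : Over S}
    (t : T.Sec X) :
    ((contract i T).power n).obj.map (toTop X).op (contractSection i T n hH) =
      (contract i T).powerMk n fun _ => contractMk i T 0 t :=
  (NatTrans.naturality_apply (powerContract i T n) (toTop X).op _).symm.trans
    ((congrArg _ (T.canonicalSection_map n hH t)).trans (powerContract_mk i T n _))

end Torsor

/-- An `A[n]`-torsor `T` gives the contraction product of `A` and `T` over `A[n]`, together with the
section of its `n`-th power coming from the canonical section of `T^n`. -/
noncomputable def torsionToPowObj (A : Sheaf J AddCommGrpCat.{max u v}) (n : ℕ)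
    (P : BObj (torsion A n)) : BPowObj A n where
  toBObj := (BObj.induced (torsionIncl A n)).obj P
  sec := Torsor.contractSection (torsionIncl A n) P.torsor n (nsmul_torsion A n)

theorem preservesSec_induced (A : Sheaf J AddCommGrpCat.{max u v}) (n : ℕ)
    {P Q : BObj (torsion A n)} (φ : P ⟶ Q) :
    BPowObj.PreservesSec (P := torsionToPowObj A n P) (Q := torsionToPowObj A n Q)
      ((BObj.induced (torsionIncl A n)).map φ) := by
  obtain ⟨R, hR, hne⟩ := P.torsor.locally_nonempty (Over.mk (𝟙 P.base))
  refine sheaf_ext (BObj.isSheaf_pullback (BObj.Hom.base φ)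
    ((torsionToPowObj A n Q).torsor.power n)) hR fun Y f hf => ?_
  obtain ⟨t⟩ := hne f hf
  obtain rfl : f = toTop Y := by
    ext
    exact (Category.comp_id _).symm.trans (Over.w f)
  refine (NatTrans.naturality_apply (BObj.powerMap ((BObj.induced (torsionIncl A n)).map φ) n)
    (toTop Y).op _).symm.trans ?_
  refine (congrArg _ (Torsor.contractSection_map (torsionIncl A n) P.torsor n
    (nsmul_torsion A n) t)).trans ?_
  refine (BObj.powerMap_mk ((BObj.induced (torsionIncl A n)).map φ) n _).trans ?_
  refine Eq.trans ?_ (map_toTop ((torsionToPowObj A n Q).torsor.power n).obj _ _).symm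
  refine Eq.trans ?_ (Torsor.contractSection_map (torsionIncl A n) Q.torsor n
    (nsmul_torsion A n) (X := (Over.map (BObj.Hom.base φ)).obj Y) (BObj.Hom.app φ Y t)).symm
  exact congrArg _ (funext fun _ => BObj.inducedMap_app_mk (torsionIncl A n) φ t)

/-- The functor underlying the natural map `B A[n] → B_n A`. -/
noncomputable def torsionToPow (A : Sheaf J AddCommGrpCat.{max u v}) (n : ℕ) :
    BObj (torsion A n) ⥤ BPowObj A n where
  obj := torsionToPowObj A n
  map φ := ⟨(BObj.induced (torsionIncl A n)).map φ, preservesSec_induced A n φ⟩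
  map_id P := BPowObj.Hom.ext ((BObj.induced (torsionIncl A n)).map_id P)
  map_comp φ ψ := BPowObj.Hom.ext ((BObj.induced (torsionIncl A n)).map_comp φ ψ)

/-- The classifying stack `B A`, as a category over the site. -/
def classifyingStack (A : Sheaf J AddCommGrpCat.{max u v}) : BasedCategory C :=
  .ofFunctor (BObj.proj A)

/-- `B_n A`, as a category over the site. -/
def powClassifyingStack (A : Sheaf J AddCommGrpCat.{max u v}) (n : ℕ) : BasedCategory C :=
  .ofFunctor (BPowObj.proj A n)

/-- The natural map `B A[n] → B_n A`, as a functor over the site. -/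
noncomputable def naturalMap (A : Sheaf J AddCommGrpCat.{max u v}) (n : ℕ) :
    BasedFunctor (classifyingStack (torsion A n)) (powClassifyingStack A n) where
  toFunctor := torsionToPow A n
  w := rfl

/-- Multiplication by `n` on `A`. -/
def mulBy (A : Sheaf J AddCommGrpCat.{max u v}) (n : ℕ) : A ⟶ A :=
  ObjectProperty.homMk
    { app := fun U => AddCommGrpCat.ofHom (nsmulAddMonoidHom n)
      naturality := fun U V f => by
        ext a
        exact (map_nsmul (A.obj.map f).hom n a).symm }

/-- A category over a site is a stack (in groupoids): it is fibred, with fibres that are groupoids;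
morphisms form a sheaf (`glue_hom`: a compatible family of morphisms defined on the pullbacks of `a`
along the members of a covering sieve comes from a unique morphism); and descent data relative to a
covering sieve, i.e. functors over the site from the sieve to the stack, are effective. -/
structure IsStack (J : GrothendieckTopology C) (𝒳 : BasedCategory.{v', u'} C) : Prop where
  isFibered : 𝒳.p.IsFibered
  isIso_of_isHomLift_id : ∀ ⦃S : C⦄ ⦃a b : 𝒳.obj⦄ (φ : a ⟶ b), 𝒳.p.IsHomLift (𝟙 S) φ → IsIso φ
  glue_hom : ∀ ⦃a b : 𝒳.obj⦄ (f : 𝒳.p.obj a ⟶ 𝒳.p.obj b) (R : Sieve (𝒳.p.obj a)),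
    R ∈ J (𝒳.p.obj a) →
    ∀ ψ : ∀ ⦃c : 𝒳.obj⦄ (φ : c ⟶ a), R (𝒳.p.map φ) → (c ⟶ b),
      (∀ ⦃c : 𝒳.obj⦄ (φ : c ⟶ a) (h : R (𝒳.p.map φ)), 𝒳.p.map (ψ φ h) = 𝒳.p.map φ ≫ f) →
      (∀ ⦃c c' : 𝒳.obj⦄ (χ : c' ⟶ c) (φ : c ⟶ a) (h : R (𝒳.p.map φ))
        (h' : R (𝒳.p.map (χ ≫ φ))), ψ (χ ≫ φ) h' = χ ≫ ψ φ h) →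
      ∃! θ : a ⟶ b, 𝒳.p.map θ = f ∧
        ∀ ⦃c : 𝒳.obj⦄ (φ : c ⟶ a) (h : R (𝒳.p.map φ)), φ ≫ θ = ψ φ h
  effective_descent : ∀ ⦃S : C⦄ (R : Sieve S), R ∈ J S →
    ∀ D : BasedFunctor (BasedCategory.ofFunctor R.arrows.diagram) 𝒳,
      ∃ (a : 𝒳.obj) (ε : ∀ g : R.arrows.category, D.obj g ⟶ a), 𝒳.p.obj a = S ∧
        (∀ g : R.arrows.category, 𝒳.p.IsHomLift g.obj.hom (ε g)) ∧
        ∀ ⦃g g' : R.arrows.category⦄ (u : g ⟶ g'), D.map u ≫ ε g' = ε g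

/-- A functor over the base is an equivalence: it has an inverse over the base, up to isomorphisms over
the base. -/
def IsEquivalenceOver {𝒳 : BasedCategory.{v', u'} C} {𝒴 : BasedCategory.{v', u'} C}
    (F : BasedFunctor 𝒳 𝒴) : Prop :=
  ∃ G : BasedFunctor 𝒴 𝒳,
    Nonempty (F.comp G ≅ BasedFunctor.id 𝒳) ∧ Nonempty (G.comp F ≅ BasedFunctor.id 𝒴)

end TorsorStack

/-!
Let `(T, λ)` be an object of `B_n A`. Call a section `t` of `T` a root of `λ` if `(t, …, t) = λ`.
Two roots over the same object differ by an element of `A[n]`, and roots exist locally: if `λ` is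
locally the class of `(t + a₁, …, t + aₙ)`, and `b` is a local solution of `n b = a₁ + ⋯ + aₙ`, then
`t + b` is a root. So the roots of `λ` form an `A[n]`-torsor.

For an `A[n]`-torsor `T`, the map `t ↦ (1, t)` identifies `T` with the torsor of roots of `(1, κ)`.
Morphisms in `B_n A` preserve roots, and a morphism out of a contraction product is determined by
its values on the sections `(1, t)`, so the natural map is fully faithful. Conversely the inclusion
of the torsor of roots of `λ` in `T` extends to an isomorphism from its contraction product to
`(T, λ)`, so the natural map is essentially surjective.

Descent of torsors along a sieve `R` on `S` needs no cleavage: a section over `f : Y ⟶ S` of the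
glued torsor is a compatible family of sections over all members of `R` that factor through `f`.
-/

namespace TorsorStack

variable {C : Type u} [Category.{v} C] {J : GrothendieckTopology C}

/-- The sections of a sheaf on `Over S` over a morphism `f : Y ⟶ S`. The equations between morphisms
that the operations on sections take as arguments make it unnecessary to transport sections. -/
def SecAt {S : C} (F : Sheaf (J.over S) (Type (max u v))) {Y : C} (f : Y ⟶ S) : Type (max u v) :=
  F.obj.obj (op (Over.mk f))

namespace SecAt

section Restriction

variable {S : C} {F : Sheaf (J.over S) (Type (max u v))}

/-- Restriction of sections along `g : Z ⟶ Y`. -/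
def res {Y Z : C} {f : Y ⟶ S} {f' : Z ⟶ S} (g : Z ⟶ Y) (e : g ≫ f = f') (s : SecAt F f) :
    SecAt F f' :=
  F.obj.map (Over.homMk (U := Over.mk f') (V := Over.mk f) g e).op s

theorem res_res {Y Z W : C} {f : Y ⟶ S} {f' : Z ⟶ S} {f'' : W ⟶ S} {g : Z ⟶ Y} {k : W ⟶ Z}
    (e : g ≫ f = f') (e' : k ≫ f' = f'') (s : SecAt F f) :
    res k e' (res g e s) = res (k ≫ g) (by rw [Category.assoc, e, e']) s :=
  (map_eq_map_map F.obj (by rfl) s).symm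

theorem res_congr {Y Z : C} {f : Y ⟶ S} {f' : Z ⟶ S} {g g' : Z ⟶ Y} (h : g = g')
    {e : g ≫ f = f'} {e' : g' ≫ f = f'} (s : SecAt F f) : res g e s = res g' e' s := by
  subst h; rfl

theorem res_eq_self {Y : C} {f : Y ⟶ S} {g : Y ⟶ Y} (h : g = 𝟙 Y) {e : g ≫ f = f}
    (s : SecAt F f) : res g e s = s := by
  subst h
  exact ConcreteCategory.congr_hom (F.obj.map_id (op (Over.mk f))) s

theorem ext {Y : C} {f : Y ⟶ S} {s t : SecAt F f} {R : Sieve Y} (hR : R ∈ J Y)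
    (h : ∀ ⦃Z : C⦄ (g : Z ⟶ Y) {f' : Z ⟶ S} (e : g ≫ f = f'), R g → res g e s = res g e t) :
    s = t :=
  sheaf_ext (X := Over.mk f) F.property (J.overEquiv_symm_mem_over (Over.mk f) R hR)
    fun _ g hg => h g.left (Over.w g) ((Sieve.overEquiv_symm_iff R g).1 hg)

theorem glue {Y : C} {f : Y ⟶ S}
    (P : ∀ ⦃Z : C⦄ (g : Z ⟶ Y) {f' : Z ⟶ S}, g ≫ f = f' → SecAt F f' → Prop)
    (hres : ∀ ⦃Z W : C⦄ (g : Z ⟶ Y) (k : W ⟶ Z) {f' : Z ⟶ S} {f'' : W ⟶ S} (e : g ≫ f = f')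
      (e' : k ≫ f' = f'') (e'' : (k ≫ g) ≫ f = f'') (s : SecAt F f'),
      P g e s → P (k ≫ g) e'' (res k e' s))
    (huniq : ∀ ⦃Z : C⦄ (g : Z ⟶ Y) {f' : Z ⟶ S} (e : g ≫ f = f') (s t : SecAt F f'),
      P g e s → P g e t → s = t)
    {R : Sieve Y} (hR : R ∈ J Y)
    (hex : ∀ ⦃Z : C⦄ (g : Z ⟶ Y) {f' : Z ⟶ S} (e : g ≫ f = f'), R g → ∃ s, P g e s) :
    ∃ s : SecAt F f, ∀ ⦃Z : C⦄ (g : Z ⟶ Y) {f' : Z ⟶ S} (e : g ≫ f = f') (t : SecAt F f'),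
      P g e t → res g e s = t := by
  obtain ⟨s, hs⟩ := sheaf_glue (X := Over.mk f) F.property
    (fun Z g t => P g.left (Over.w g) t)
    (fun Z W g k t h => hres _ k.left (Over.w g) (Over.w k) (Over.w (k ≫ g)) _ h)
    (fun Z g t t' h h' => huniq _ _ _ _ h h')
    (J.overEquiv_symm_mem_over (Over.mk f) R hR)
    (fun Z g hg => hex g.left (Over.w g) ((Sieve.overEquiv_symm_iff R g).1 hg))
  exact ⟨s, fun Z g f' e t ht => hs (Over.homMk (U := Over.mk f') (V := Over.mk f) g e) t ht⟩

end Restriction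

section Map

variable {S S' : C} {b : S ⟶ S'} {F : Sheaf (J.over S) (Type (max u v))}
  {G : Sheaf (J.over S') (Type (max u v))} (α : F.obj ⟶ (Over.map b).op ⋙ G.obj)

/-- The map on sections over `f` given by a map from `F` to the restriction of `G` along `b`. -/
def map {Y : C} {f : Y ⟶ S} {f' : Y ⟶ S'} (e : f ≫ b = f') (s : SecAt F f) : SecAt G f' :=
  res (f := f ≫ b) (𝟙 Y) (by simpa using e) (α.app (op (Over.mk f)) s)

theorem map_rfl {Y : C} {f : Y ⟶ S} (s : SecAt F f) :
    map α (f := f) rfl s = α.app (op (Over.mk f)) s :=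
  res_eq_self rfl _

theorem map_res {Y Z : C} {f : Y ⟶ S} {f' : Y ⟶ S'} (e : f ≫ b = f') {k : Z ⟶ S} (g : Z ⟶ Y)
    (eg : g ≫ f = k) {k' : Z ⟶ S'} (e' : k ≫ b = k') (s : SecAt F f) :
    map α e' (res g eg s) = res g (by rw [← e, ← e', ← eg, Category.assoc]) (map α e s) := by
  subst e e' eg
  rw [map_rfl, map_rfl]
  exact NatTrans.naturality_apply α (Over.homMk (U := Over.mk (g ≫ f)) (V := Over.mk f) g).op s

theorem map_bijective
    (hinj : ∀ ⦃Y : C⦄ ⦃f : Y ⟶ S⦄ ⦃f' : Y ⟶ S'⦄ (e : f ≫ b = f'), Function.Injective (map α e))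
    {Y : C} {f : Y ⟶ S} {f' : Y ⟶ S'} (e : f ≫ b = f')
    (hsurj : ∀ t : SecAt G f', ∃ R ∈ J Y, ∀ ⦃Z : C⦄ (g : Z ⟶ Y), R g → ∀ ⦃k : Z ⟶ S⦄ ⦃k' : Z ⟶ S'⦄
      (_ : g ≫ f = k) (ek' : g ≫ f' = k') (ek : k ≫ b = k'), ∃ s, map α ek s = res g ek' t) :
    Function.Bijective (map α e) := by
  refine ⟨hinj e, fun t => ?_⟩
  obtain ⟨R, hR, hloc⟩ := hsurj t
  have comp_eq {Z : C} {g : Z ⟶ Y} {k : Z ⟶ S} (eg : g ≫ f = k) : k ≫ b = g ≫ f' := by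
    rw [← eg, ← e, Category.assoc]
  obtain ⟨s, hs⟩ := glue (F := F) (f := f) (fun Z g k eg s => map α (comp_eq eg) s = res g rfl t)
    (fun Z W g k _ _ eg e' e'' s h => by rw [map_res α (comp_eq eg) k e', h, res_res])
    (fun Z g k eg s s' h h' => hinj _ (h.trans h'.symm)) hR
    (fun Z g k eg hg => hloc g hg eg rfl (comp_eq eg))
  refine ⟨s, ext hR fun Z g k' ek' hg => ?_⟩
  obtain ⟨r, hr⟩ := hloc g hg rfl ek' (by rw [Category.assoc, e, ek'])
  subst ek'
  rw [← hr, ← hs g rfl r hr, map_res]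

end Map

end SecAt

namespace Torsor

variable {A : Sheaf J AddCommGrpCat.{max u v}} {S : C} {T : Torsor A S}

instance {Y : C} (f : Y ⟶ S) : AddAction (Grp A Y) (SecAt T.sheaf f) :=
  T.act (Over.mk f)

theorem res_vadd {Y Z : C} {f : Y ⟶ S} {f' : Z ⟶ S} (g : Z ⟶ Y) (e : g ≫ f = f')
    (a : Grp A Y) (s : SecAt T.sheaf f) :
    SecAt.res g e (a +ᵥ s) = A.obj.map g.op a +ᵥ SecAt.res g e s :=
  T.map_vadd (Over.homMk (U := Over.mk f') (V := Over.mk f) g e) a s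

theorem secAt_vadd_cancel {Y : C} {f : Y ⟶ S} {a b : Grp A Y} {s : SecAt T.sheaf f}
    (h : a +ᵥ s = b +ᵥ s) : a = b :=
  T.vadd_cancel (X := Over.mk f) h

theorem secAt_exists_vadd_eq {Y : C} {f : Y ⟶ S} (s t : SecAt T.sheaf f) :
    ∃ a : Grp A Y, a +ᵥ s = t :=
  T.exists_vadd_eq (X := Over.mk f) s t

theorem exists_cover_nonempty (T : Torsor A S) {Y : C} (f : Y ⟶ S) :
    ∃ R ∈ J Y, ∀ ⦃Z : C⦄ (g : Z ⟶ Y) {f' : Z ⟶ S}, g ≫ f = f' → R g →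
      Nonempty (SecAt T.sheaf f') := by
  obtain ⟨R, hR, h⟩ := T.locally_nonempty (Over.mk f)
  refine ⟨_, (J.mem_over_iff R).1 hR, fun Z g f' e hg => ?_⟩
  subst e
  exact h _ ((Sieve.overEquiv_iff R g).1 hg)

variable (T) in
/-- The section of `T^n` over `f` given by a tuple of sections of `T`. -/
noncomputable def powMk (n : ℕ) {Y : C} {f : Y ⟶ S} (x : Fin n → SecAt T.sheaf f) :
    SecAt (T.power n) f :=
  T.powerMk n (X := Over.mk f) x

variable {n : ℕ}

theorem res_powMk {Y Z : C} {f : Y ⟶ S} {f' : Z ⟶ S} (g : Z ⟶ Y) (e : g ≫ f = f')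
    (x : Fin n → SecAt T.sheaf f) :
    SecAt.res g e (T.powMk n x) = T.powMk n fun i => SecAt.res g e (x i) :=
  T.powerMk_map n (Over.homMk (U := Over.mk f') (V := Over.mk f) g e) x

theorem exists_cover_powMk {Y : C} {f : Y ⟶ S} (s : SecAt (T.power n) f) :
    ∃ R ∈ J Y, ∀ ⦃Z : C⦄ (g : Z ⟶ Y) {f' : Z ⟶ S} (e : g ≫ f = f'), R g →
      ∃ x : Fin n → SecAt T.sheaf f', SecAt.res g e s = T.powMk n x := by
  obtain ⟨R, hR, h⟩ := T.power_locally_mk n (X := Over.mk f) s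
  refine ⟨_, (J.mem_over_iff R).1 hR, fun Z g f' e hg => ?_⟩
  subst e
  exact h _ ((Sieve.overEquiv_iff R g).1 hg)

theorem sum_eq_zero_of_powMk_vadd_eq {Y : C} {f : Y ⟶ S} {a : Fin n → Grp A Y}
    {x : Fin n → SecAt T.sheaf f} (h : T.powMk n (fun i => a i +ᵥ x i) = T.powMk n x) :
    ∑ i, a i = 0 := by
  obtain ⟨R, hR, h⟩ := sheafify_locally_eq (K := J.over S) (T.powerPresheaf n) h
  refine sheaf_ext (isSheaf_forget A) ((J.mem_over_iff R).1 hR) fun Z g hg => ?_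
  obtain ⟨b, hb, h⟩ := Quotient.exact (s := T.powerSetoid n _)
    (h _ ((Sieve.overEquiv_iff R g).1 hg))
  have map_eq_neg (i : Fin n) : A.obj.map g.op (a i) = -b i := by
    have h1 : (SecAt.res g rfl (x i) : SecAt T.sheaf (g ≫ f)) =
      b i +ᵥ SecAt.res g rfl (a i +ᵥ x i) := congrFun h i
    rw [res_vadd, vadd_vadd] at h1
    have h2 := secAt_vadd_cancel ((zero_vadd (Grp A Z) _).trans h1)
    exact (neg_eq_of_add_eq_zero_right h2.symm).symm
  change A.obj.map g.op (∑ i, a i) = A.obj.map g.op 0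
  rw [map_zero, map_sum, Finset.sum_congr rfl fun i _ => map_eq_neg i, Finset.sum_neg_distrib, hb,
    neg_zero]

theorem powMk_vadd_eq_iff {Y : C} {f : Y ⟶ S} {a : Fin n → Grp A Y}
    {x : Fin n → SecAt T.sheaf f} :
    T.powMk n (fun i => a i +ᵥ x i) = T.powMk n x ↔ ∑ i, a i = 0 :=
  ⟨sum_eq_zero_of_powMk_vadd_eq, fun h => T.powerMk_vadd n (X := Over.mk f) a h x⟩

end Torsor

namespace BObj

variable {A : Sheaf J AddCommGrpCat.{max u v}} {P Q R : BObj A}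

namespace Hom

/-- The map of sheaves underlying a morphism of torsors. -/
def natTrans (φ : P ⟶ Q) :
    P.torsor.sheaf.obj ⟶ (Over.map (Hom.base φ)).op ⋙ Q.torsor.sheaf.obj where
  app X := TypeCat.ofHom (Hom.app φ X.unop)
  naturality X Y f := by
    ext s
    exact Hom.naturality φ f.unop s

/-- The map on sections over `f` given by a morphism of torsors. -/
def on (φ : P ⟶ Q) {Y : C} {f : Y ⟶ P.base} {f' : Y ⟶ Q.base} (e : f ≫ Hom.base φ = f')
    (s : SecAt P.torsor.sheaf f) : SecAt Q.torsor.sheaf f' :=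
  SecAt.map (natTrans φ) e s

theorem on_res (φ : P ⟶ Q) {Y Z : C} {f : Y ⟶ P.base} {f' : Y ⟶ Q.base}
    (e : f ≫ Hom.base φ = f') {k : Z ⟶ P.base} (g : Z ⟶ Y) (eg : g ≫ f = k)
    {k' : Z ⟶ Q.base} (e' : k ≫ Hom.base φ = k') (s : SecAt P.torsor.sheaf f) :
    on φ e' (SecAt.res g eg s) =
      SecAt.res g (by rw [← e, ← e', ← eg, Category.assoc]) (on φ e s) :=
  SecAt.map_res _ e g eg e' s

theorem on_rfl (φ : P ⟶ Q) {Y : C} {f : Y ⟶ P.base} (s : SecAt P.torsor.sheaf f) :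
    on φ rfl s = Hom.app φ (Over.mk f) s :=
  SecAt.map_rfl _ s

theorem on_vadd (φ : P ⟶ Q) {Y : C} {f : Y ⟶ P.base} {f' : Y ⟶ Q.base}
    (e : f ≫ Hom.base φ = f') (a : Grp A Y) (s : SecAt P.torsor.sheaf f) :
    on φ e (a +ᵥ s) = a +ᵥ on φ e s := by
  subst e
  rw [on_rfl, on_rfl]
  exact Hom.map_vadd φ (Over.mk f) a s

theorem on_comp (φ : P ⟶ Q) (ψ : Q ⟶ R) {Y : C} {f : Y ⟶ P.base} {f' : Y ⟶ Q.base}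
    {f'' : Y ⟶ R.base} (e : f ≫ Hom.base φ = f') (e' : f' ≫ Hom.base ψ = f'')
    (e'' : f ≫ Hom.base (φ ≫ ψ) = f'') (s : SecAt P.torsor.sheaf f) :
    on (φ ≫ ψ) e'' s = on ψ e' (on φ e s) := by
  subst e e'
  rw [on_rfl, on_rfl]
  refine (SecAt.res_res (f := (f ≫ Hom.base φ) ≫ Hom.base ψ) (f' := f ≫ Hom.base (φ ≫ ψ))
    (g := 𝟙 Y) (k := 𝟙 Y) (by simpa using e''.symm) (by simpa using e'') _).trans
      (SecAt.res_eq_self (by simp) _)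

theorem on_congr {φ ψ : P ⟶ Q} (h : φ = ψ) {Y : C} {f : Y ⟶ P.base} {f' : Y ⟶ Q.base}
    (e : f ≫ Hom.base φ = f') (e' : f ≫ Hom.base ψ = f') (s : SecAt P.torsor.sheaf f) :
    on φ e s = on ψ e' s := by
  subst h; rfl

theorem ext_on {φ ψ : P ⟶ Q} (hb : Hom.base φ = Hom.base ψ)
    (h : ∀ ⦃Y : C⦄ (f : Y ⟶ P.base) (f' : Y ⟶ Q.base) (e : f ≫ Hom.base φ = f')
      (e' : f ≫ Hom.base ψ = f') (s : SecAt P.torsor.sheaf f), on φ e s = on ψ e' s) : φ = ψ := by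
  refine Hom.ext' hb fun X t e he => ?_
  have app_eq := (on_rfl φ (f := X.hom) t).symm.trans (h X.hom _ rfl (by rw [hb]) t)
  refine Eq.trans ?_ app_eq.symm
  refine congrArg (fun g => Q.torsor.sheaf.obj.map (Quiver.Hom.op g) (Hom.app ψ X t)) ?_
  ext
  exact he

theorem exists_hom_on_eq (b : P.base ⟶ Q.base)
    (l : ∀ ⦃Y : C⦄ (f : Y ⟶ P.base) (f' : Y ⟶ Q.base), f ≫ b = f' →
      SecAt P.torsor.sheaf f → SecAt Q.torsor.sheaf f')
    (l_res : ∀ ⦃Y Z : C⦄ (f : Y ⟶ P.base) (f' : Y ⟶ Q.base) (e : f ≫ b = f') (k : Z ⟶ P.base)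
      (k' : Z ⟶ Q.base) (e' : k ≫ b = k') (g : Z ⟶ Y) (eg : g ≫ f = k) (eg' : g ≫ f' = k')
      (s : SecAt P.torsor.sheaf f),
      l k k' e' (SecAt.res g eg s) = SecAt.res g eg' (l f f' e s))
    (l_vadd : ∀ ⦃Y : C⦄ (f : Y ⟶ P.base) (f' : Y ⟶ Q.base) (e : f ≫ b = f') (a : Grp A Y)
      (s : SecAt P.torsor.sheaf f), l f f' e (a +ᵥ s) = a +ᵥ l f f' e s) :
    ∃ φ : P ⟶ Q, Hom.base φ = b ∧ ∀ ⦃Y : C⦄ (f : Y ⟶ P.base) (f' : Y ⟶ Q.base) (e : f ≫ b = f')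
      (e' : f ≫ Hom.base φ = f') (s : SecAt P.torsor.sheaf f), on φ e' s = l f f' e s := by
  let φ : P ⟶ Q :=
    { base := b
      app := fun X s => l X.hom _ rfl s
      naturality := fun X Y f s => l_res X.hom _ rfl Y.hom _ rfl f.left (Over.w f)
        (Over.w ((Over.map b).map f)) s
      map_vadd := fun X a s => l_vadd X.hom _ rfl a s }
  refine ⟨φ, rfl, fun Y f f' e e' s => ?_⟩
  subst e
  exact on_rfl φ s

theorem on_injective (φ : P ⟶ Q) {Y : C} {f : Y ⟶ P.base} {f' : Y ⟶ Q.base}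
    (e : f ≫ Hom.base φ = f') : Function.Injective (on φ e) := fun s t h => by
  obtain ⟨a, rfl⟩ := Torsor.secAt_exists_vadd_eq s t
  rw [on_vadd] at h
  rw [← Torsor.secAt_vadd_cancel ((zero_vadd (Grp A Y) _).trans h), zero_vadd]

theorem on_bijective (φ : P ⟶ Q) {Y : C} {f : Y ⟶ P.base} {f' : Y ⟶ Q.base}
    (e : f ≫ Hom.base φ = f') : Function.Bijective (on φ e) := by
  refine SecAt.map_bijective _ (fun _ _ _ => on_injective φ) e fun t => ?_
  obtain ⟨R, hR, h⟩ := P.torsor.exists_cover_nonempty f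
  refine ⟨R, hR, fun Z g hg k k' eg ek' ek => ?_⟩
  obtain ⟨s⟩ := h g eg hg
  obtain ⟨a, ha⟩ := Torsor.secAt_exists_vadd_eq (on φ ek s) (SecAt.res g ek' t)
  exact ⟨a +ᵥ s, (on_vadd φ ek a s).trans ha⟩

theorem existsUnique_lift (φ : P ⟶ Q) (ψ : R ⟶ Q) (b : R.base ⟶ P.base)
    (hb : b ≫ Hom.base φ = Hom.base ψ) : ∃! χ : R ⟶ P, Hom.base χ = b ∧ χ ≫ φ = ψ := by
  have comp_eq {Y : C} {f : Y ⟶ R.base} {f' : Y ⟶ P.base} (e : f ≫ b = f') :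
      f' ≫ Hom.base φ = f ≫ Hom.base ψ := by rw [← e, Category.assoc, hb]
  choose l hl using fun (Y : C) (f : Y ⟶ R.base) (f' : Y ⟶ P.base) (e : f ≫ b = f')
    (s : SecAt R.torsor.sheaf f) => (on_bijective φ (comp_eq e)).2 (on ψ rfl s)
  obtain ⟨χ, rfl, hχ⟩ := exists_hom_on_eq b l
    (fun Y Z f f' e k k' e' g eg eg' s => on_injective φ (comp_eq e') <| by
      rw [hl, on_res φ (comp_eq e), hl, on_res ψ rfl])
    (fun Y f f' e a s => on_injective φ (comp_eq e) <| by rw [hl, on_vadd ψ, on_vadd φ, hl])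
  refine ⟨χ, ⟨rfl, ext_on hb fun Y f f' e e' s => ?_⟩, fun χ' ⟨hbase, hcomp⟩ =>
    ext_on hbase fun Y f f' e e' s => on_injective φ (comp_eq e') ?_⟩
  · subst e'
    rw [on_comp χ φ rfl (comp_eq rfl), hχ _ _ rfl, hl]
  · rw [hχ _ _ e', hl, ← on_comp χ' φ e (comp_eq e') (by rw [hcomp])]
    exact on_congr hcomp _ _ s

end Hom

/-- The pullback of a torsor along a morphism to its base. -/
def pull (P : BObj A) {Y : C} (b : Y ⟶ P.base) : BObj A where
  base := Y
  torsor :=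
    { sheaf := (J.overMapPullback (Type (max u v)) b).obj P.torsor.sheaf
      act := fun X => P.torsor.act ((Over.map b).obj X)
      map_vadd := fun _ _ g a t => P.torsor.map_vadd ((Over.map b).map g) a t
      simply_transitive := fun X => P.torsor.simply_transitive ((Over.map b).obj X)
      locally_nonempty := fun X => by
        obtain ⟨R, hR, h⟩ := P.torsor.exists_cover_nonempty (X.hom ≫ b)
        refine ⟨_, J.overEquiv_symm_mem_over X R hR, fun Z g hg => ?_⟩
        exact h g.left (Over.w ((Over.map b).map g)) ((Sieve.overEquiv_symm_iff R g).1 hg) }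

/-- The projection from the pullback of a torsor to the torsor. -/
def pullHom (P : BObj A) {Y : C} (b : Y ⟶ P.base) : pull P b ⟶ P where
  base := b
  app _ t := t
  naturality _ _ _ _ := rfl
  map_vadd _ _ _ := rfl

theorem exists_pull (P : BObj A) {Y : C} (b : Y ⟶ P.base) :
    ∃ (Q : BObj A) (π : Q ⟶ P) (i : Y ≅ Q.base), i.hom ≫ Hom.base π = b :=
  ⟨pull P b, pullHom P b, Iso.refl Y, Category.id_comp b⟩

namespace Hom

variable {n : ℕ}

/-- The map on sections of the `n`-th powers over `f` given by a morphism of torsors. -/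
noncomputable def powOn (φ : P ⟶ Q) (n : ℕ) {Y : C} {f : Y ⟶ P.base} {f' : Y ⟶ Q.base}
    (e : f ≫ Hom.base φ = f') (s : SecAt (P.torsor.power n) f) : SecAt (Q.torsor.power n) f' :=
  SecAt.map (powerMap φ n) e s

theorem powOn_res (φ : P ⟶ Q) {Y Z : C} {f : Y ⟶ P.base} {f' : Y ⟶ Q.base}
    (e : f ≫ Hom.base φ = f') {k : Z ⟶ P.base} (g : Z ⟶ Y) (eg : g ≫ f = k)
    {k' : Z ⟶ Q.base} (e' : k ≫ Hom.base φ = k') (s : SecAt (P.torsor.power n) f) :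
    powOn φ n e' (SecAt.res g eg s) =
      SecAt.res g (by rw [← e, ← e', ← eg, Category.assoc]) (powOn φ n e s) :=
  SecAt.map_res _ e g eg e' s

theorem powOn_powMk (φ : P ⟶ Q) {Y : C} {f : Y ⟶ P.base} {f' : Y ⟶ Q.base}
    (e : f ≫ Hom.base φ = f') (x : Fin n → SecAt P.torsor.sheaf f) :
    powOn φ n e (P.torsor.powMk n x) = Q.torsor.powMk n fun i => on φ e (x i) := by
  subst e
  refine (SecAt.map_rfl _ _).trans ((powerMap_mk φ n _).trans ?_)
  exact congrArg _ (funext fun i => (on_rfl φ (x i)).symm)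

theorem powOn_comp (φ : P ⟶ Q) (ψ : Q ⟶ R) {Y : C} {f : Y ⟶ P.base} {f' : Y ⟶ Q.base}
    {f'' : Y ⟶ R.base} (e : f ≫ Hom.base φ = f') (e' : f' ≫ Hom.base ψ = f'')
    (e'' : f ≫ Hom.base (φ ≫ ψ) = f'') (s : SecAt (P.torsor.power n) f) :
    powOn (φ ≫ ψ) n e'' s = powOn ψ n e' (powOn φ n e s) := by
  subst e e'
  unfold powOn
  rw [SecAt.map_rfl, SecAt.map_rfl]
  refine (congrArg (SecAt.res _ _) (powerMap_comp φ ψ n s)).trans ?_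
  refine (SecAt.res_res (f := (f ≫ Hom.base φ) ≫ Hom.base ψ) (f' := f ≫ Hom.base (φ ≫ ψ))
    (g := 𝟙 Y) (k := 𝟙 Y) (by simpa using e''.symm) (by simpa using e'') _).trans
      (SecAt.res_eq_self (by simp) _)

theorem powOn_injective (φ : P ⟶ Q) {Y : C} {f : Y ⟶ P.base} {f' : Y ⟶ Q.base}
    (e : f ≫ Hom.base φ = f') : Function.Injective (powOn φ n e) := fun s t h => by
  obtain ⟨R, hR, hs⟩ := Torsor.exists_cover_powMk s
  obtain ⟨R', hR', ht⟩ := Torsor.exists_cover_powMk t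
  refine SecAt.ext (J.intersection_covering hR hR') fun Z g k eg hg => ?_
  obtain ⟨x, hx⟩ := hs g eg hg.1
  obtain ⟨y, hy⟩ := ht g eg hg.2
  choose a ha using fun i => Torsor.secAt_exists_vadd_eq (x i) (y i)
  obtain rfl : (fun i => a i +ᵥ x i) = y := funext ha
  have ek : k ≫ Hom.base φ = g ≫ f' := by rw [← e, ← eg, Category.assoc]
  have h' := congrArg (SecAt.res g rfl) h
  rw [← powOn_res φ e g eg ek, ← powOn_res φ e g eg ek, hx, hy, powOn_powMk, powOn_powMk] at h'
  simp only [on_vadd] at h'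
  rw [hx, hy, Torsor.powMk_vadd_eq_iff.2 (Torsor.powMk_vadd_eq_iff.1 h'.symm)]

theorem powOn_bijective (φ : P ⟶ Q) {Y : C} {f : Y ⟶ P.base} {f' : Y ⟶ Q.base}
    (e : f ≫ Hom.base φ = f') : Function.Bijective (powOn φ n e) := by
  refine SecAt.map_bijective _ (fun _ _ _ => powOn_injective φ) e fun t => ?_
  obtain ⟨R, hR, h⟩ := Torsor.exists_cover_powMk t
  refine ⟨R, hR, fun Z g hg k k' _ ek' ek => ?_⟩
  obtain ⟨x, hx⟩ := h g ek' hg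
  choose y hy using fun i => (on_bijective φ ek).2 (x i)
  exact ⟨P.torsor.powMk n y, by rw [hx, ← funext hy]; exact powOn_powMk φ ek y⟩

end Hom

end BObj

namespace BPowObj

open BObj

variable {A : Sheaf J AddCommGrpCat.{max u v}} {n : ℕ} {P Q R : BPowObj A n}

/-- The restriction of the global section of the `n`-th power to a section over `f`. -/
noncomputable def secAt (P : BPowObj A n) {Y : C} (f : Y ⟶ P.base) :
    SecAt (P.torsor.power n) f :=
  SecAt.res (f := 𝟙 P.base) f (Category.comp_id f) P.sec

theorem res_secAt (P : BPowObj A n) {Y Z : C} (f : Y ⟶ P.base) {f' : Z ⟶ P.base} (g : Z ⟶ Y)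
    (e : g ≫ f = f') : SecAt.res g e (P.secAt f) = P.secAt f' :=
  (SecAt.res_res _ _ _).trans (SecAt.res_congr e _)

theorem preservesSec_iff (φ : P.toBObj ⟶ Q.toBObj) :
    PreservesSec φ ↔ ∀ ⦃Y : C⦄ (f : Y ⟶ P.base) (f' : Y ⟶ Q.base)
      (e : f ≫ BObj.Hom.base φ = f'), Hom.powOn φ n e (P.secAt f) = Q.secAt f' := by
  have powOn_sec : Hom.powOn φ n rfl (P.secAt (𝟙 P.base)) =
      (powerMap φ n).app (op (Over.mk (𝟙 P.base))) P.sec :=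
    (SecAt.map_rfl _ _).trans (congrArg _ (SecAt.res_eq_self rfl P.sec))
  refine ⟨fun h Y f f' e => ?_, fun h => powOn_sec.symm.trans (h _ _ rfl)⟩
  rw [← res_secAt P (𝟙 P.base) f (Category.comp_id f), Hom.powOn_res φ rfl]
  exact (congrArg (SecAt.res _ _) (powOn_sec.trans h)).trans
    (res_secAt Q (𝟙 P.base ≫ BObj.Hom.base φ) f _)

theorem preservesSec_of_cover {φ : P.toBObj ⟶ Q.toBObj} {R : Sieve P.base} (hR : R ∈ J P.base)
    (h : ∀ ⦃Y : C⦄ (f : Y ⟶ P.base) (f' : Y ⟶ Q.base) (e : f ≫ BObj.Hom.base φ = f'), R f →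
      Hom.powOn φ n e (P.secAt f) = Q.secAt f') : PreservesSec φ := by
  refine (preservesSec_iff φ).2 fun Y f f' e =>
    SecAt.ext (J.pullback_stable f hR) fun Z g k eg hg => ?_
  rw [← Hom.powOn_res φ e g rfl (by rw [Category.assoc, e, eg]), res_secAt, res_secAt]
  exact h _ _ _ hg

end BPowObj

section Cartesian

variable {𝒳 : Type u'} [Category.{v'} 𝒳] {p : 𝒳 ⥤ C}

theorem isStronglyCartesian_of_existsUnique_lift {a b : 𝒳} (φ : a ⟶ b)
    (h : ∀ ⦃c : 𝒳⦄ (ψ : c ⟶ b) (g : p.obj c ⟶ p.obj a), g ≫ p.map φ = p.map ψ →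
      ∃! χ : c ⟶ a, p.map χ = g ∧ χ ≫ φ = ψ) : p.IsStronglyCartesian (p.map φ) φ where
  universal_property' {c} g ψ hψ := by
    obtain ⟨χ, ⟨rfl, hcomp⟩, huniq⟩ := h ψ g (IsHomLift.eq_of_isHomLift p _ ψ)
    exact ⟨χ, ⟨inferInstance, hcomp⟩, fun χ' ⟨hlift, hcomp'⟩ =>
      huniq χ' ⟨(IsHomLift.eq_of_isHomLift p _ χ').symm, hcomp'⟩⟩

variable (h : ∀ ⦃a b c : 𝒳⦄ (φ : a ⟶ b) (ψ : c ⟶ b) (g : p.obj c ⟶ p.obj a),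
  g ≫ p.map φ = p.map ψ → ∃! χ : c ⟶ a, p.map χ = g ∧ χ ≫ φ = ψ)

include h

theorem isFibered_of_existsUnique_lift
    (hpull : ∀ (a : 𝒳) (S : C) (f : S ⟶ p.obj a), ∃ (b : 𝒳) (φ : b ⟶ a), p.IsHomLift f φ) :
    p.IsFibered :=
  .of_exists_isStronglyCartesian fun a S f => by
    obtain ⟨b, φ, hφ⟩ := hpull a S f
    obtain rfl := IsHomLift.domain_eq p f φ
    rw [IsHomLift.eq_of_isHomLift p f φ]
    exact ⟨b, φ, isStronglyCartesian_of_existsUnique_lift φ fun c ψ g => h φ ψ g⟩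

theorem isIso_of_isHomLift_id {S : C} {a b : 𝒳} (φ : a ⟶ b) (hφ : p.IsHomLift (𝟙 S) φ) :
    IsIso φ := by
  have : IsIso (p.map φ) := by
    rw [IsHomLift.fac' p (𝟙 S) φ]
    infer_instance
  have := isStronglyCartesian_of_existsUnique_lift φ fun c ψ g => h φ ψ g
  exact Functor.IsStronglyCartesian.isIso_of_base_isIso p (p.map φ) φ

end Cartesian

namespace BObj

variable {A : Sheaf J AddCommGrpCat.{max u v}} {P Q : BObj A}

namespace Hom

theorem ext_of_cover {φ ψ : P ⟶ Q} (hb : Hom.base φ = Hom.base ψ) {R : Sieve P.base}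
    (hR : R ∈ J P.base) (h : ∀ ⦃Y : C⦄ (f : Y ⟶ P.base) (f' : Y ⟶ Q.base)
      (e : f ≫ Hom.base φ = f') (e' : f ≫ Hom.base ψ = f') (s : SecAt P.torsor.sheaf f), R f →
        on φ e s = on ψ e' s) : φ = ψ := by
  refine ext_on hb fun Y f f' e e' s =>
    SecAt.ext (J.pullback_stable f hR) fun Z g k eg hg => ?_
  rw [← on_res φ e g rfl (by rw [Category.assoc, e, eg]),
    ← on_res ψ e' g rfl (by rw [Category.assoc, e', eg])]
  exact h _ _ _ _ _ hg

theorem exists_on_eq {R : Sieve P.base} {Y : C} {f : Y ⟶ P.base} (hf : R f)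
    (s : SecAt P.torsor.sheaf f) : ∃ (c : BObj A) (φ : c ⟶ P) (_ : R (Hom.base φ))
      (m : Y ⟶ c.base) (e : m ≫ Hom.base φ = f) (r : SecAt c.torsor.sheaf m), on φ e r = s := by
  obtain ⟨c, φ, i, rfl⟩ := exists_pull P f
  exact ⟨c, φ, by simpa using R.downward_closed hf i.inv, i.hom, rfl, (on_bijective φ rfl).2 s⟩

theorem on_eq_on_of_compatible {R : Sieve P.base}
    {ψ : ∀ ⦃c : BObj A⦄ (φ : c ⟶ P), R (Hom.base φ) → (c ⟶ Q)}
    (hψ : ∀ ⦃c c' : BObj A⦄ (χ : c' ⟶ c) (φ : c ⟶ P) (h : R (Hom.base φ))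
      (h' : R (Hom.base (χ ≫ φ))), ψ (χ ≫ φ) h' = χ ≫ ψ φ h)
    {c c' : BObj A} {φ : c ⟶ P} (h : R (Hom.base φ)) {φ' : c' ⟶ P} (h' : R (Hom.base φ'))
    {Y : C} {m : Y ⟶ c.base} {m' : Y ⟶ c'.base} {f : Y ⟶ P.base} {f' : Y ⟶ Q.base}
    {e : m ≫ Hom.base φ = f} {e' : m' ≫ Hom.base φ' = f}
    (e₁ : m ≫ Hom.base (ψ φ h) = f') (e₁' : m' ≫ Hom.base (ψ φ' h') = f')
    {s : SecAt c.torsor.sheaf m} {s' : SecAt c'.torsor.sheaf m'}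
    (hs : on φ e s = on φ' e' s') : on (ψ φ h) e₁ s = on (ψ φ' h') e₁' s' := by
  obtain ⟨d, π, i, hi⟩ := exists_pull c m
  have i_comp {W : C} (g : Y ⟶ W) : i.hom ≫ i.inv ≫ g = g := by simp
  have eπ : i.hom ≫ Hom.base (π ≫ φ) = f := (Category.assoc ..).symm.trans (by rw [hi, e])
  have base_eq : Hom.base (π ≫ φ) = i.inv ≫ f := (Iso.eq_inv_comp i).2 eπ
  obtain ⟨χ, ⟨hχ, hcomp⟩, -⟩ := existsUnique_lift φ' (π ≫ φ) (i.inv ≫ m')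
    (by rw [Category.assoc, e', base_eq])
  obtain ⟨r, rfl⟩ := (on_bijective π hi).2 s
  have eχ : i.hom ≫ Hom.base χ = m' := by rw [hχ, i_comp]
  have on_lift : on χ eχ r = s' := on_injective φ' e' <| by
    rw [← hs, ← on_comp χ φ' eχ e' (hcomp ▸ eπ), ← on_comp π φ hi e eπ]
    exact on_congr hcomp _ _ r
  have comp_eq : π ≫ ψ φ h = χ ≫ ψ φ' h' := by
    have hc : R (Hom.base (π ≫ φ)) := R.downward_closed h _
    rw [← hψ _ _ _ hc, ← hψ χ φ' h' (hcomp ▸ hc)]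
    simp only [hcomp]
  have eψ : i.hom ≫ Hom.base (π ≫ ψ φ h) = f' :=
    (Category.assoc ..).symm.trans (by rw [hi, e₁])
  rw [← on_lift, ← on_comp π (ψ φ h) hi e₁ eψ, ← on_comp χ (ψ φ' h') eχ e₁' (comp_eq ▸ eψ)]
  exact on_congr comp_eq _ _ r

end Hom

section Glue

open Hom

variable {b : P.base ⟶ Q.base} {R : Sieve P.base}
  {ψ : ∀ ⦃c : BObj A⦄ (φ : c ⟶ P), R (Hom.base φ) → (c ⟶ Q)}

variable (ψ) in
/-- The section `t` is the image of `s` under the morphism glued from the family `ψ`: this holds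
locally, where `s` comes from a torsor on which `ψ` is defined. -/
def IsGluedImage {Y : C} {f : Y ⟶ P.base} {f' : Y ⟶ Q.base} (s : SecAt P.torsor.sheaf f)
    (t : SecAt Q.torsor.sheaf f') : Prop :=
  ∀ ⦃Z : C⦄ (g : Z ⟶ Y) ⦃k : Z ⟶ P.base⦄ ⦃k' : Z ⟶ Q.base⦄ (eg : g ≫ f = k) (eg' : g ≫ f' = k')
    ⦃c : BObj A⦄ (φ : c ⟶ P) (h : R (Hom.base φ)) (m : Z ⟶ c.base) (em : m ≫ Hom.base φ = k)
    (em' : m ≫ Hom.base (ψ φ h) = k') (r : SecAt c.torsor.sheaf m),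
    on φ em r = SecAt.res g eg s → on (ψ φ h) em' r = SecAt.res g eg' t

namespace IsGluedImage

variable {Y : C} {f : Y ⟶ P.base} {f' : Y ⟶ Q.base} {s : SecAt P.torsor.sheaf f}
  {t t' : SecAt Q.torsor.sheaf f'}

theorem res (h : IsGluedImage ψ s t) {Z : C} (g : Z ⟶ Y) {k : Z ⟶ P.base} {k' : Z ⟶ Q.base}
    (eg : g ≫ f = k) (eg' : g ≫ f' = k') :
    IsGluedImage ψ (SecAt.res g eg s) (SecAt.res g eg' t) :=
  fun W j _ _ ej ej' c φ hφ m em em' r => by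
    rw [SecAt.res_res, SecAt.res_res]
    exact h _ _ _ φ hφ m em em' r

theorem vadd (h : IsGluedImage ψ s t) (a : Grp A Y) : IsGluedImage ψ (a +ᵥ s) (a +ᵥ t) :=
  fun Z g k k' eg eg' c φ hφ m em em' r hr => by
    rw [Torsor.res_vadd, ← neg_vadd_eq_iff, ← on_vadd φ] at hr
    rw [Torsor.res_vadd, ← neg_vadd_eq_iff, ← on_vadd (ψ φ hφ)]
    exact h g eg eg' φ hφ m em em' _ hr

theorem unique (hbase : ∀ ⦃c : BObj A⦄ (φ : c ⟶ P) (h : R (Hom.base φ)),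
      Hom.base (ψ φ h) = Hom.base φ ≫ b) (hR : R ∈ J P.base) (e : f ≫ b = f')
    (h : IsGluedImage ψ s t) (h' : IsGluedImage ψ s t') : t = t' :=
  SecAt.ext (J.pullback_stable f hR) fun Z g k' eg' hg => by
    obtain ⟨c, φ, hφ, m, em, r, hr⟩ := exists_on_eq hg (SecAt.res g rfl s)
    have em' : m ≫ Hom.base (ψ φ hφ) = k' := by
      rw [hbase, ← Category.assoc, em, Category.assoc, e, eg']
    rw [← h g rfl eg' φ hφ m em em' r hr, ← h' g rfl eg' φ hφ m em em' r hr]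

end IsGluedImage

variable (hbase : ∀ ⦃c : BObj A⦄ (φ : c ⟶ P) (h : R (Hom.base φ)),
    Hom.base (ψ φ h) = Hom.base φ ≫ b)
  (hψ : ∀ ⦃c c' : BObj A⦄ (χ : c' ⟶ c) (φ : c ⟶ P) (h : R (Hom.base φ))
    (h' : R (Hom.base (χ ≫ φ))), ψ (χ ≫ φ) h' = χ ≫ ψ φ h) (hR : R ∈ J P.base)

include hψ

theorem isGluedImage_on {c : BObj A} (φ : c ⟶ P) (h : R (Hom.base φ)) {Y : C} {m : Y ⟶ c.base}
    {f : Y ⟶ P.base} {f' : Y ⟶ Q.base} (em : m ≫ Hom.base φ = f)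
    (em' : m ≫ Hom.base (ψ φ h) = f') (r : SecAt c.torsor.sheaf m) :
    IsGluedImage ψ (on φ em r) (on (ψ φ h) em' r) :=
  fun Z g k k' eg eg' d φ' h' m' _ _ r' hr' => by
    rw [← on_res φ em g rfl (by rw [Category.assoc, em, eg])] at hr'
    rw [← on_res (ψ φ h) em' g rfl (by rw [Category.assoc, em', eg'])]
    exact on_eq_on_of_compatible hψ h' h _ _ hr'

include hbase hR

theorem exists_isGluedImage {Y : C} {f : Y ⟶ P.base} {f' : Y ⟶ Q.base} (e : f ≫ b = f')
    (s : SecAt P.torsor.sheaf f) : ∃ t : SecAt Q.torsor.sheaf f', IsGluedImage ψ s t := by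
  have comp_eq {Z : C} {g : Z ⟶ Y} {k' : Z ⟶ Q.base} (eg' : g ≫ f' = k') : (g ≫ f) ≫ b = k' := by
    rw [Category.assoc, e, eg']
  obtain ⟨t, ht⟩ := SecAt.glue (F := Q.torsor.sheaf) (f := f')
    (fun Z g k' _ t => IsGluedImage ψ (SecAt.res g rfl s) t)
    (fun Z W g k k' k'' _ e' _ t h => by
      have := h.res k (k := (k ≫ g) ≫ f) (Category.assoc ..).symm e'
      rwa [SecAt.res_res] at this)
    (fun Z g k' eg' t t' h h' => h.unique hbase hR (comp_eq eg') h')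
    (J.pullback_stable f hR)
    (fun Z g k' eg' hg => by
      obtain ⟨c, φ, hφ, m, em, r, hr⟩ := exists_on_eq hg (SecAt.res g rfl s)
      rw [← hr]
      exact ⟨_, isGluedImage_on hψ φ hφ em
        (by rw [hbase, ← Category.assoc, em, comp_eq eg']) r⟩)
  refine ⟨t, fun Z g k k' eg eg' c φ hφ m em em' r hr => ?_⟩
  subst eg
  refine (ht g eg' _ ?_).symm
  rw [← hr]
  exact isGluedImage_on hψ φ hφ em em' r

theorem existsUnique_glue_hom : ∃! θ : P ⟶ Q, Hom.base θ = b ∧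
    ∀ ⦃c : BObj A⦄ (φ : c ⟶ P) (h : R (Hom.base φ)), φ ≫ θ = ψ φ h := by
  choose l hl using fun (Y : C) (f : Y ⟶ P.base) (f' : Y ⟶ Q.base) (e : f ≫ b = f') =>
    exists_isGluedImage hbase hψ hR e
  obtain ⟨θ, rfl, hθ⟩ := exists_hom_on_eq b l
    (fun Y Z f f' e k k' e' g eg eg' s =>
      (hl _ _ _ e' _).unique hbase hR e' ((hl _ _ _ e s).res g eg eg'))
    (fun Y f f' e a s => (hl _ _ _ e _).unique hbase hR e ((hl _ _ _ e s).vadd a))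
  have comp_θ ⦃c : BObj A⦄ (φ : c ⟶ P) (h : R (Hom.base φ)) : φ ≫ θ = ψ φ h := by
    refine ext_on (hbase φ h).symm fun Y f f' e e' s => ?_
    have eθ : (f ≫ Hom.base φ) ≫ Hom.base θ = f' := (Category.assoc ..).trans e
    rw [on_comp φ θ rfl eθ, hθ _ _ eθ]
    exact (hl _ _ _ eθ _).unique hbase hR eθ (isGluedImage_on hψ φ h rfl e' s)
  refine ⟨θ, ⟨rfl, comp_θ⟩, fun θ' ⟨hθ'base, hθ'⟩ =>
    ext_of_cover hθ'base hR fun Y f f' e e' s hf => ?_⟩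
  obtain ⟨d, π, hπ, m, rfl, r, rfl⟩ := exists_on_eq hf s
  rw [← on_comp π θ' rfl e ((Category.assoc ..).symm.trans e),
    ← on_comp π θ rfl e' ((Category.assoc ..).symm.trans e')]
  exact on_congr ((hθ' _ hπ).trans (comp_θ _ hπ).symm) _ _ _

end Glue

end BObj

section Descent

variable {A : Sheaf J AddCommGrpCat.{max u v}} {S : C} {R : Sieve S}

variable (A R) in
/-- A descent datum for `A`-torsors relative to a sieve `R`: a torsor over each member of `R`, up to
a specified identification of the bases, and compatible morphisms between these torsors. -/
structure DescentDatum where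
  obj ⦃Y : C⦄ (f : Y ⟶ S) (hf : R f) : BObj A
  iso ⦃Y : C⦄ (f : Y ⟶ S) (hf : R f) : Y ≅ (obj f hf).base
  map ⦃Y Z : C⦄ {f : Y ⟶ S} {f' : Z ⟶ S} (hf : R f) (hf' : R f') (g : Z ⟶ Y) (e : g ≫ f = f') :
    obj f' hf' ⟶ obj f hf
  iso_comp_base_map ⦃Y Z : C⦄ {f : Y ⟶ S} {f' : Z ⟶ S} (hf : R f) (hf' : R f') (g : Z ⟶ Y)
    (e : g ≫ f = f') : (iso f' hf').hom ≫ BObj.Hom.base (map hf hf' g e) = g ≫ (iso f hf).hom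
  map_comp_map ⦃Y Z W : C⦄ {f : Y ⟶ S} {f' : Z ⟶ S} {f'' : W ⟶ S} (hf : R f) (hf' : R f')
    (hf'' : R f'') (g : Z ⟶ Y) (e : g ≫ f = f') (k : W ⟶ Z) (e' : k ≫ f' = f'')
    (e'' : (k ≫ g) ≫ f = f'') : map hf' hf'' k e' ≫ map hf hf' g e = map hf hf'' (k ≫ g) e''

namespace DescentDatum

open BObj.Hom

variable (D : DescentDatum A R)

/-- The sections over `f` of the torsor that the descent datum provides over `f`. -/
abbrev Sec {Y : C} (f : Y ⟶ S) (hf : R f) : Type (max u v) :=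
  SecAt (D.obj f hf).torsor.sheaf (D.iso f hf).hom

variable {D}

section Restrict

variable {Y Z W : C} {f : Y ⟶ S} {f' : Z ⟶ S} {f'' : W ⟶ S} {hf : R f} {hf' : R f'} {hf'' : R f''}

/-- Restriction of sections along `g`, through the morphism `D.map g` of torsors. -/
noncomputable def restrict (g : Z ⟶ Y) (e : g ≫ f = f') (s : D.Sec f hf) : D.Sec f' hf' :=
  (Equiv.ofBijective _ (on_bijective (D.map hf hf' g e) (D.iso_comp_base_map hf hf' g e))).symm
    (SecAt.res g rfl s)

theorem restrict_eq_iff {g : Z ⟶ Y} {e : g ≫ f = f'} {s : D.Sec f hf} {t : D.Sec f' hf'} :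
    restrict g e s = t ↔
      SecAt.res g rfl s = on (D.map hf hf' g e) (D.iso_comp_base_map hf hf' g e) t :=
  Equiv.symm_apply_eq _

theorem on_restrict (g : Z ⟶ Y) (e : g ≫ f = f') (s : D.Sec f hf) :
    on (D.map hf hf' g e) (D.iso_comp_base_map hf hf' g e) (restrict g e s) =
      SecAt.res g rfl s :=
  (restrict_eq_iff.1 rfl).symm

theorem on_map_restrict (g : Z ⟶ Y) (e : g ≫ f = f') (k : W ⟶ Z) (e' : k ≫ f' = f'')
    {g' : W ⟶ Y} (eg : k ≫ g = g') (e'' : g' ≫ f = f'') {m : Z ⟶ (D.obj f hf).base}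
    {m' : W ⟶ (D.obj f hf).base}
    (em : (D.iso f' hf').hom ≫ BObj.Hom.base (D.map hf hf' g e) = m)
    (em' : (D.iso f'' hf'').hom ≫ BObj.Hom.base (D.map hf hf'' g' e'') = m')
    (ek : k ≫ m = m') (s : D.Sec f' hf') :
    on (D.map hf hf'' g' e'') em' (restrict k e' s) =
      SecAt.res k ek (on (D.map hf hf' g e) em s) := by
  subst eg
  have comp_eq : (k ≫ (D.iso f' hf').hom) ≫ BObj.Hom.base (D.map hf hf' g e) = m' := by
    rw [Category.assoc, em, ek]
  have map_eq := D.map_comp_map hf hf' hf'' g e k e' e''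
  rw [on_congr map_eq.symm em' (map_eq ▸ em'), on_comp _ _ (D.iso_comp_base_map hf' hf'' k e')
    comp_eq, on_restrict, on_res (D.map hf hf' g e) em]

theorem restrict_restrict (g : Z ⟶ Y) (e : g ≫ f = f') (k : W ⟶ Z) (e' : k ≫ f' = f'')
    (s : D.Sec f hf) : (restrict k e' (restrict g e s : D.Sec f' hf') : D.Sec f'' hf'') =
      restrict (k ≫ g) (by rw [Category.assoc, e, e']) s :=
  (restrict_eq_iff.2 <| by
    rw [on_map_restrict g e k e' rfl _ (D.iso_comp_base_map hf hf' g e) _ (Category.assoc ..).symm,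
      on_restrict, SecAt.res_res]).symm

theorem restrict_vadd (g : Z ⟶ Y) (e : g ≫ f = f') (a : Grp A Y) (s : D.Sec f hf) :
    (restrict g e (a +ᵥ s) : D.Sec f' hf') = A.obj.map g.op a +ᵥ (restrict g e s : D.Sec f' hf') :=
  restrict_eq_iff.2 <| by
    rw [on_vadd (D.map hf hf' g e), on_restrict, Torsor.res_vadd]

theorem sec_ext {s t : D.Sec f hf} {K : Sieve Y} (hK : K ∈ J Y)
    (h : ∀ ⦃Z : C⦄ (g : Z ⟶ Y) {f' : Z ⟶ S} (e : g ≫ f = f') (hf' : R f'), K g →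
      (restrict g e s : D.Sec f' hf') = restrict g e t) : s = t :=
  SecAt.ext hK fun Z g _ eg hg => by
    subst eg
    have hgf := R.downward_closed hf g
    rw [← on_restrict (hf' := hgf) g rfl s, h g rfl hgf hg, on_restrict]

theorem sec_glue
    (P : ∀ ⦃Z : C⦄ (g : Z ⟶ Y) {f' : Z ⟶ S} (hf' : R f'), g ≫ f = f' → D.Sec f' hf' → Prop)
    (hres : ∀ ⦃Z W : C⦄ (g : Z ⟶ Y) (k : W ⟶ Z) {f' : Z ⟶ S} {f'' : W ⟶ S} (hf' : R f')
      (hf'' : R f'') (e : g ≫ f = f') (e' : k ≫ f' = f'') (e'' : (k ≫ g) ≫ f = f'')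
      (s : D.Sec f' hf'), P g hf' e s → P (k ≫ g) hf'' e'' (restrict k e' s))
    (huniq : ∀ ⦃Z : C⦄ (g : Z ⟶ Y) {f' : Z ⟶ S} (hf' : R f') (e : g ≫ f = f')
      (s t : D.Sec f' hf'), P g hf' e s → P g hf' e t → s = t)
    {K : Sieve Y} (hK : K ∈ J Y)
    (hex : ∀ ⦃Z : C⦄ (g : Z ⟶ Y) {f' : Z ⟶ S} (hf' : R f') (e : g ≫ f = f'), K g →
      ∃ s, P g hf' e s) :
    ∃ s : D.Sec f hf, ∀ ⦃Z : C⦄ (g : Z ⟶ Y) {f' : Z ⟶ S} (hf' : R f') (e : g ≫ f = f')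
      (t : D.Sec f' hf'), P g hf' e t → restrict g e s = t := by
  have hgf {Z : C} (g : Z ⟶ Y) : R (g ≫ f) := R.downward_closed hf g
  have base_eq {Z : C} {g : Z ⟶ Y} {k : Z ⟶ (D.obj f hf).base} (e : g ≫ (D.iso f hf).hom = k) :=
    (D.iso_comp_base_map hf (hgf g) g rfl).trans e
  obtain ⟨s, hs⟩ := SecAt.glue (f := (D.iso f hf).hom)
    (fun Z g k e s => ∃ r, P g (hgf g) rfl r ∧ on (D.map hf (hgf g) g rfl) (base_eq e) r = s)
    (fun Z W g k m m' e e' e'' s ⟨r, hr, hs⟩ => by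
      refine ⟨restrict k (Category.assoc ..).symm r, hres g k _ _ _ _ _ r hr, ?_⟩
      rw [on_map_restrict g rfl k _ rfl _ (base_eq e) _ e', hs])
    (fun Z g k e s t ⟨r, hr, hs⟩ ⟨r', hr', ht⟩ => by
      rw [← hs, ← ht, huniq g _ rfl r r' hr hr'])
    hK (fun Z g k e hg => by
      obtain ⟨r, hr⟩ := hex g (hgf g) rfl hg
      exact ⟨_, r, hr, rfl⟩)
  refine ⟨s, fun Z g f' hf' e t ht => ?_⟩
  subst e
  exact restrict_eq_iff.2 (hs g rfl _ ⟨t, ht, rfl⟩)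

end Restrict

variable (D) in
/-- A compatible family of sections, over the members of `R` that factor through `f`, of the torsors
in the descent datum: a section over `f` of the torsor glued from the descent datum. -/
@[ext]
structure Family {Y : C} (f : Y ⟶ S) where
  val ⦃Z : C⦄ (g : Z ⟶ Y) ⦃k : Z ⟶ S⦄ (e : g ≫ f = k) (hk : R k) : D.Sec k hk
  restrict_val ⦃Z W : C⦄ (g : Z ⟶ Y) ⦃k : Z ⟶ S⦄ (e : g ≫ f = k) (hk : R k) (j : W ⟶ Z)
    ⦃g' : W ⟶ Y⦄ ⦃k' : W ⟶ S⦄ (eg : j ≫ g = g') (ek : j ≫ k = k') (e' : g' ≫ f = k')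
    (hk' : R k') : restrict j ek (val g e hk) = val g' e' hk'

namespace Family

variable {Y Z : C} {f : Y ⟶ S} {f' : Z ⟶ S}

theorem val_congr (F : D.Family f) {g g' : Z ⟶ Y} (h : g = g') (e : g ≫ f = f')
    (e' : g' ≫ f = f') (hk : R f') : F.val g e hk = F.val g' e' hk := by
  subst h; rfl

/-- Restriction of compatible families along `g`. -/
@[simps]
def res (g : Z ⟶ Y) (e : g ≫ f = f') (F : D.Family f) : D.Family f' where
  val _ h _ eh hk := F.val (h ≫ g) (by rw [Category.assoc, e, eh]) hk
  restrict_val _ _ h _ _ hk j _ _ eg ek _ hk' :=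
    F.restrict_val _ _ hk j (by rw [← Category.assoc, eg]) ek _ hk'

theorem ext_of_cover {F F' : D.Family f} {K : Sieve Y} (hK : K ∈ J Y)
    (h : ∀ ⦃Z : C⦄ (g : Z ⟶ Y) ⦃k : Z ⟶ S⦄ (e : g ≫ f = k) (hk : R k), K g →
      F.val g e hk = F'.val g e hk) : F = F' := by
  ext Z g k e hk
  refine sec_ext (J.pullback_stable g hK) fun W j k' ek hk' hj => ?_
  have e' : (j ≫ g) ≫ f = k' := by rw [Category.assoc, e, ek]
  rw [F.restrict_val g e hk j rfl ek e' hk', F'.restrict_val g e hk j rfl ek e' hk',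
    h _ _ _ hj]

theorem exists_val_eq {K : Sieve Y} (hK : K ∈ J Y)
    (y : ∀ ⦃Z : C⦄ (g : Z ⟶ Y) ⦃k : Z ⟶ S⦄ (_ : g ≫ f = k) (hk : R k), K g → D.Sec k hk)
    (hy : ∀ ⦃Z W : C⦄ (g : Z ⟶ Y) ⦃k : Z ⟶ S⦄ (e : g ≫ f = k) (hk : R k) (hg : K g) (j : W ⟶ Z)
      ⦃g' : W ⟶ Y⦄ ⦃k' : W ⟶ S⦄ (_ : j ≫ g = g') (ek : j ≫ k = k') (e' : g' ≫ f = k') (hk' : R k')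
      (hg' : K g'), restrict j ek (y g e hk hg) = y g' e' hk' hg') :
    ∃ F : D.Family f, ∀ ⦃Z : C⦄ (g : Z ⟶ Y) ⦃k : Z ⟶ S⦄ (e : g ≫ f = k) (hk : R k) (hg : K g),
      F.val g e hk = y g e hk hg := by
  have comp_eq {Z W : C} {g : Z ⟶ Y} {k : Z ⟶ S} {j : W ⟶ Z} {k' : W ⟶ S} (e : g ≫ f = k)
      (ek : j ≫ k = k') : (j ≫ g) ≫ f = k' := by rw [Category.assoc, e, ek]
  have val_exists {Z : C} (g : Z ⟶ Y) {k : Z ⟶ S} (e : g ≫ f = k) (hk : R k) :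
      ∃ s : D.Sec k hk, ∀ ⦃W : C⦄ (j : W ⟶ Z) ⦃k' : W ⟶ S⦄ (ek : j ≫ k = k') (hk' : R k')
        (hj : K (j ≫ g)), restrict j ek s = y (j ≫ g) (comp_eq e ek) hk' hj := by
    obtain ⟨s, hs⟩ := sec_glue (hf := hk)
      (fun W j k' hk' ek s => ∃ hj : K (j ≫ g), s = y (j ≫ g) (comp_eq e ek) hk' hj)
      (fun W V j i k' k'' hk' hk'' ek ek' _ s ⟨hj, hs⟩ => by
        have hij : K ((i ≫ j) ≫ g) := by rw [Category.assoc]; exact K.downward_closed hj i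
        exact ⟨hij, by rw [hs]; exact hy _ _ _ hj i (Category.assoc ..).symm ek' _ hk'' hij⟩)
      (fun W j k' hk' ek s t ⟨_, hs⟩ ⟨_, ht⟩ => hs.trans ht.symm)
      (J.pullback_stable g hK) (fun W j k' hk' ek hj => ⟨_, hj, rfl⟩)
    exact ⟨s, fun W j k' ek hk' hj => hs j hk' ek _ ⟨hj, rfl⟩⟩
  choose val hval using @val_exists
  have restrict_val {Z W : C} (g : Z ⟶ Y) {k : Z ⟶ S} (e : g ≫ f = k) (hk : R k) (j : W ⟶ Z)
      {g' : W ⟶ Y} {k' : W ⟶ S} (eg : j ≫ g = g') (ek : j ≫ k = k') (e' : g' ≫ f = k')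
      (hk' : R k') : restrict j ek (val g e hk) = val g' e' hk' := by
    subst eg
    refine sec_ext (J.pullback_stable (j ≫ g) hK) fun V i k'' ek' hk'' hi => ?_
    have hi' : K ((i ≫ j) ≫ g) := by rw [Category.assoc]; exact hi
    rw [restrict_restrict, hval g e hk _ _ hk'' hi', hval _ e' hk' i ek' hk'' hi]
    simp only [Category.assoc]
  refine ⟨⟨fun Z g k => val g, fun Z W g k e hk j g' k' => restrict_val g e hk j⟩,
    fun Z g k e hk hg => sec_ext (J.top_mem Z) fun W j k' ek hk' _ => ?_⟩
  rw [hval g e hk j ek hk' (K.downward_closed hg j)]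
  exact (hy g e hk hg j rfl ek _ hk' _).symm

instance : AddAction (Grp A Y) (D.Family f) where
  vadd a F :=
    { val := fun _ g _ e hk => A.obj.map g.op a +ᵥ F.val g e hk
      restrict_val := fun Z W g k e hk j g' k' eg ek e' hk' => by
        subst eg
        rw [restrict_vadd, F.restrict_val g e hk j rfl ek e' hk', op_comp, A.obj.map_comp]
        rfl }
  zero_vadd F := Family.ext <| by
    funext Z g k e hk
    exact (congrArg (· +ᵥ F.val g e hk) (map_zero (A.obj.map g.op).hom)).trans (zero_vadd _ _)
  add_vadd a b F := Family.ext <| by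
    funext Z g k e hk
    exact (congrArg (· +ᵥ F.val g e hk) (map_add (A.obj.map g.op).hom a b)).trans (add_vadd _ _ _)

theorem val_vadd (a : Grp A Y) (F : D.Family f) (g : Z ⟶ Y) (e : g ≫ f = f') (hk : R f') :
    (a +ᵥ F).val g e hk = A.obj.map g.op a +ᵥ F.val g e hk :=
  rfl

theorem res_vadd (g : Z ⟶ Y) (e : g ≫ f = f') (a : Grp A Y) (F : D.Family f) :
    res g e (a +ᵥ F) = A.obj.map g.op a +ᵥ res g e F := Family.ext <| by
  funext W h k eh hk
  rw [res_val, val_vadd, val_vadd, res_val, op_comp, A.obj.map_comp]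
  rfl

/-- The compatible family of the restrictions of a section. -/
noncomputable def ofSec {hf : R f} (s : D.Sec f hf) : D.Family f where
  val _ g _ e _ := restrict g e s
  restrict_val _ _ g k e hk j _ _ eg _ _ _ := by
    subst eg
    exact restrict_restrict (hf' := hk) g e j _ s

theorem exists_vadd_eq (hR : R ∈ J S) (F F' : D.Family f) : ∃ a : Grp A Y, a +ᵥ F = F' := by
  choose a ha using fun (Z : C) (g : Z ⟶ Y) (hg : R (g ≫ f)) =>
    Torsor.secAt_exists_vadd_eq (F.val g rfl hg) (F'.val g rfl hg)
  obtain ⟨a', ha'⟩ := sheaf_glue (isSheaf_forget A)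
    (fun Z g b => ∃ hg : R (g ≫ f), b = a Z g hg)
    (fun Z W g j b ⟨hg, hb⟩ => by
      have hjg : R ((j ≫ g) ≫ f) := by
        rw [Category.assoc]
        exact R.downward_closed hg j
      refine ⟨hjg, Torsor.secAt_vadd_cancel (s := F.val (j ≫ g) rfl hjg) ?_⟩
      have := congrArg (restrict (hf' := hjg) j (Category.assoc ..).symm) (ha Z g hg)
      rw [restrict_vadd, F.restrict_val g rfl hg j rfl _ rfl hjg,
        F'.restrict_val g rfl hg j rfl _ rfl hjg] at this
      rw [hb, ha]
      exact this)
    (fun Z g b b' ⟨_, hb⟩ ⟨_, hb'⟩ => hb.trans hb'.symm)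
    (J.pullback_stable f hR) (fun Z g hg => ⟨_, hg, rfl⟩)
  refine ⟨a', Family.ext ?_⟩
  funext Z g k e hk
  subst e
  rw [val_vadd, ← ha]
  exact congrArg (· +ᵥ F.val g rfl hk) (ha' g _ ⟨hk, rfl⟩)

theorem vadd_cancel (hR : R ∈ J S) {a b : Grp A Y} {F : D.Family f} (h : a +ᵥ F = b +ᵥ F) :
    a = b :=
  sheaf_ext (isSheaf_forget A) (J.pullback_stable f hR) fun _ g (hg : R (g ≫ f)) =>
    Torsor.secAt_vadd_cancel (s := F.val g rfl hg) (congrArg (fun F => F.val g rfl hg) h)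

theorem mem_of_nonempty (hR : R ∈ J S) {K : Sieve Y}
    (hK : ∀ ⦃Z⦄ (g : Z ⟶ Y), Nonempty (D.Family (g ≫ f)) → K g) : K ∈ J Y := by
  refine J.transitive (J.pullback_stable f hR) K fun _ g (hg : R (g ≫ f)) => ?_
  obtain ⟨K', hK', h⟩ := (D.obj _ hg).torsor.exists_cover_nonempty (D.iso _ hg).hom
  refine J.superset_covering (fun W j hj => hK _ ?_) hK'
  obtain ⟨s⟩ := h j rfl hj
  have hjg : R ((j ≫ g) ≫ f) := by
    rw [Category.assoc]
    exact R.downward_closed hg j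
  obtain ⟨r, -⟩ := (on_bijective (D.map hg hjg j (Category.assoc ..).symm)
    (D.iso_comp_base_map hg hjg j _)).2 s
  exact ⟨ofSec r⟩

end Family

variable (D) in
/-- The presheaf on `Over S` of compatible families of sections of the torsors in the descent
datum. -/
noncomputable def familyPresheaf : (Over S)ᵒᵖ ⥤ Type (max u v) where
  obj X := D.Family X.unop.hom
  map φ := TypeCat.ofHom (Family.res φ.unop.left (Over.w φ.unop))
  map_id X := by
    ext F Z g k e hk
    exact F.val_congr (Category.comp_id g) _ _ hk
  map_comp φ ψ := by
    ext F Z g k e hk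
    exact F.val_congr (Category.assoc ..).symm _ _ hk

theorem isSheaf_familyPresheaf : Presheaf.IsSheaf (J.over S) D.familyPresheaf := by
  rw [isSheaf_iff_isSheaf_of_type]
  intro X K hK x hx
  obtain ⟨K, rfl⟩ := (Sieve.overEquiv X).symm.surjective K
  rw [J.mem_over_iff, OrderIso.apply_symm_apply] at hK
  rw [Presieve.compatible_iff_sieveCompatible] at hx
  have val_id {Y : Over S} {g : Y ⟶ X} (hg : K g.left) {Z : C} (h : Z ⟶ Y.left) {k : Z ⟶ S}
      (eh : h ≫ Y.hom = k) (hk : R k) {g' : Over.mk k ⟶ X}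
      (eg : Over.homMk (U := Over.mk k) h eh ≫ g = g') (hg' : K g'.left) :
      (x g' hg').val (𝟙 Z) (Category.id_comp k) hk = (x g hg).val h eh hk := by
    subst eg
    have res_x := congrArg (fun F => Family.val F (𝟙 Z) (Category.id_comp k) hk)
      (hx g (Over.homMk (U := Over.mk k) h eh) hg)
    exact res_x.trans ((x g hg).val_congr (Category.id_comp h) _ _ hk)
  obtain ⟨F, hF⟩ := Family.exists_val_eq (D := D) (f := X.hom) hK
    (fun Z g k e hk hg =>
      (x (Over.homMk (U := Over.mk k) g e) hg).val (𝟙 Z) (Category.id_comp k) hk)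
    (fun Z W g k e hk hg j g' k' eg ek e' hk' hg' =>
      (Family.restrict_val _ _ _ _ _ (Category.comp_id j) _ _ _).trans
        (val_id (g := Over.homMk (U := Over.mk k) g e) hg j ek hk' (by ext; exact eg) hg').symm)
  refine ⟨F, fun Y g hg => Family.ext ?_, fun F' hF' =>
    Family.ext_of_cover hK fun Z g k e hk hg => ?_⟩
  · funext Z h k eh hk
    exact (hF (h ≫ g.left) (by rw [Category.assoc, Over.w, eh]) hk (K.downward_closed hg h)).trans
      (val_id hg h eh hk (by ext; rfl) _)
  · rw [hF g e hk hg, ← hF' (Over.homMk (U := Over.mk k) g e) hg]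
    exact F'.val_congr (Category.id_comp g).symm _ _ hk

/-- The torsor glued from a descent datum relative to a covering sieve. -/
noncomputable def glue (D : DescentDatum A R) (hR : R ∈ J S) : BObj A where
  base := S
  torsor :=
    { sheaf := ⟨D.familyPresheaf, isSheaf_familyPresheaf⟩
      act := fun X => inferInstanceAs (AddAction (Grp A X.left) (D.Family X.hom))
      map_vadd := fun X Y g a F => Family.res_vadd g.left (Over.w g) a F
      simply_transitive := fun X => by
        refine ⟨fun ⟨a, F⟩ ⟨b, F'⟩ h => ?_, fun ⟨F, F'⟩ => ?_⟩
        · obtain ⟨rfl, h⟩ := Prod.mk.inj h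
          exact congrArg (·, F) (Family.vadd_cancel hR h)
        · obtain ⟨a, ha⟩ := Family.exists_vadd_eq hR F F'
          exact ⟨(a, F), congrArg (F, ·) ha⟩
      locally_nonempty := fun X => by
        let K : Sieve X.left :=
          { arrows := fun Z g => Nonempty (D.Family (g ≫ X.hom))
            downward_closed := fun ⟨F⟩ j => ⟨F.res j (Category.assoc ..).symm⟩ }
        refine ⟨_, J.overEquiv_symm_mem_over X K (Family.mem_of_nonempty hR fun Z g h => h),
          fun Y g hg => ?_⟩
        obtain ⟨F⟩ := (Sieve.overEquiv_symm_iff K g).1 hg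
        exact ⟨F.res (𝟙 _) ((Category.id_comp _).trans (Over.w g))⟩ }

theorem ofSec_restrict {Y Z : C} {f : Y ⟶ S} {f' : Z ⟶ S} {hf : R f} {hf' : R f'} (g : Z ⟶ Y)
    (e : g ≫ f = f') (s : D.Sec f hf) :
    Family.ofSec (restrict g e s : D.Sec f' hf') = (Family.ofSec s).res g e := Family.ext <| by
  funext W h k eh hk
  exact restrict_restrict g e h eh s

theorem ofSec_vadd {Y : C} {f : Y ⟶ S} {hf : R f} (a : Grp A Y) (s : D.Sec f hf) :
    Family.ofSec (a +ᵥ s) = a +ᵥ Family.ofSec s := Family.ext <| by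
  funext W h k eh hk
  exact restrict_vadd h eh a s

variable (D) in
theorem exists_hom_glue_on_eq (hR : R ∈ J S) {Y : C} (f : Y ⟶ S) (hf : R f) :
    ∃ ε : D.obj f hf ⟶ D.glue hR, BObj.Hom.base ε = (D.iso f hf).inv ≫ f ∧
      ∀ ⦃Z : C⦄ (g : Z ⟶ Y) ⦃k : Z ⟶ S⦄ (e : g ≫ f = k) (hk : R k) ⦃m : Z ⟶ (D.obj f hf).base⦄
        (em : (D.iso k hk).hom ≫ BObj.Hom.base (D.map hf hk g e) = m)
        (em' : m ≫ BObj.Hom.base ε = k) (r : D.Sec k hk),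
        on ε em' (on (D.map hf hk g e) em r) = Family.ofSec r := by
  have mem {Z : C} {m : Z ⟶ (D.obj f hf).base} {k : Z ⟶ S} (e : m ≫ (D.iso f hf).inv ≫ f = k) :
      R k := e ▸ R.downward_closed (R.downward_closed hf _) _
  have base_eq {Z : C} {m : Z ⟶ (D.obj f hf).base} {k : Z ⟶ S} (hk : R k)
      (e' : (m ≫ (D.iso f hf).inv) ≫ f = k) :
      (D.iso k hk).hom ≫ BObj.Hom.base (D.map hf hk (m ≫ (D.iso f hf).inv) e') = m := by
    rw [D.iso_comp_base_map, Category.assoc, Iso.inv_hom_id, Category.comp_id]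
  choose l hl using fun (Z : C) (m : Z ⟶ (D.obj f hf).base) (k : Z ⟶ S)
    (e : m ≫ (D.iso f hf).inv ≫ f = k) => (on_bijective (D.map hf (mem e) _ _)
      (base_eq (mem e) ((Category.assoc ..).trans e))).2
  have l_res {Z W : C} {m : Z ⟶ (D.obj f hf).base} {k : Z ⟶ S} (e) {m' : W ⟶ (D.obj f hf).base}
      {k' : W ⟶ S} (e') {j : W ⟶ Z} (em : j ≫ m = m') (ek : j ≫ k = k') (s) :
      l W m' k' e' (SecAt.res j em s) = restrict j ek (l Z m k e s) :=
    on_injective _ (base_eq (mem e') ((Category.assoc ..).trans e')) <| by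
      rw [hl, on_map_restrict (m ≫ (D.iso f hf).inv) ((Category.assoc ..).trans e) j ek
        (by rw [← Category.assoc, em]) _ (base_eq (mem e) _) _ em, hl]
  have l_vadd {Z : C} {m : Z ⟶ (D.obj f hf).base} {k : Z ⟶ S} (e) (a : Grp A Z) (s) :
      l Z m k e (a +ᵥ s) = a +ᵥ l Z m k e s :=
    on_injective _ (base_eq (mem e) ((Category.assoc ..).trans e)) <|
      (hl ..).trans ((on_vadd _ _ a _).trans (congrArg (a +ᵥ ·) (hl ..))).symm
  obtain ⟨ε, hb, hε⟩ := exists_hom_on_eq (Q := D.glue hR) ((D.iso f hf).inv ≫ f)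
    (fun Z m k e s => Family.ofSec (l Z m k e s))
    (fun Z W m k e m' k' e' j em ek s =>
      (congrArg Family.ofSec (l_res e e' em ek s)).trans (ofSec_restrict j ek _))
    (fun Z m k e a s => (congrArg Family.ofSec (l_vadd e a s)).trans (ofSec_vadd a _))
  refine ⟨ε, hb, fun Z g k e hk m em em' r => ?_⟩
  have eg : m ≫ (D.iso f hf).inv = g := by
    rw [← em, D.iso_comp_base_map, Category.assoc, Iso.hom_inv_id, Category.comp_id]
  subst eg
  rw [hε m k ((Category.assoc ..).symm.trans e)]
  exact congrArg Family.ofSec (on_injective _ em (hl ..))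

theorem base_map_comp_inv_comp {Y Z : C} {f : Y ⟶ S} {f' : Z ⟶ S} (hf : R f) (hf' : R f')
    (g : Z ⟶ Y) (e : g ≫ f = f') :
    BObj.Hom.base (D.map hf hf' g e) ≫ (D.iso f hf).inv ≫ f = (D.iso f' hf').inv ≫ f' := by
  rw [(Iso.eq_inv_comp _).2 (D.iso_comp_base_map hf hf' g e)]
  simp only [Category.assoc, Iso.hom_inv_id_assoc, e]

variable (D) in
theorem exists_compatible_hom_glue (hR : R ∈ J S) :
    ∃ ε : ∀ ⦃Y : C⦄ (f : Y ⟶ S) (hf : R f), D.obj f hf ⟶ D.glue hR,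
      (∀ ⦃Y : C⦄ (f : Y ⟶ S) (hf : R f), BObj.Hom.base (ε f hf) = (D.iso f hf).inv ≫ f) ∧
      ∀ ⦃Y Z : C⦄ {f : Y ⟶ S} {f' : Z ⟶ S} (hf : R f) (hf' : R f') (g : Z ⟶ Y) (e : g ≫ f = f'),
        D.map hf hf' g e ≫ ε f hf = ε f' hf' := by
  choose ε hb hε using fun (Y : C) (f : Y ⟶ S) => D.exists_hom_glue_on_eq hR f
  refine ⟨ε, hb, fun Y Z f f' hf hf' g e => ?_⟩
  have base_eq : BObj.Hom.base (D.map hf hf' g e ≫ ε Y f hf) = BObj.Hom.base (ε Z f' hf') :=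
    (congrArg (_ ≫ ·) (hb Y f hf)).trans
      ((base_map_comp_inv_comp hf hf' g e).trans (hb Z f' hf').symm)
  refine ext_on base_eq fun W m (k : W ⟶ S) ek ek' s => ?_
  have eh : (m ≫ (D.iso f' hf').inv) ≫ f' = k :=
    (Category.assoc ..).trans ((congrArg (m ≫ ·) (hb Z f' hf')).symm.trans ek')
  have hk : R k := eh ▸ R.downward_closed hf' _
  have em : (D.iso k hk).hom ≫ BObj.Hom.base (D.map hf' hk _ eh) = m := by
    rw [D.iso_comp_base_map, Category.assoc, Iso.inv_hom_id, Category.comp_id]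
  obtain ⟨r, rfl⟩ := (on_bijective (D.map hf' hk _ eh) em).2 s
  have map_eq := D.map_comp_map hf hf' hk g e _ eh (by rw [Category.assoc, e, eh])
  have em' : (D.iso k hk).hom ≫ BObj.Hom.base (D.map hf' hk _ eh ≫ D.map hf hf' g e) =
      m ≫ BObj.Hom.base (D.map hf hf' g e) :=
    (Category.assoc ..).symm.trans (congrArg (· ≫ _) em)
  have on_map := (on_comp _ _ em rfl em' r).symm.trans (on_congr map_eq em' (map_eq ▸ em') r)
  exact (on_comp _ _ rfl ((Category.assoc ..).trans ek) ek _).trans <|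
    (congrArg (on (ε Y f hf) _) on_map).trans <|
    (hε Y f hf _ _ hk _ _ r).trans (hε Z f' hf' _ eh hk em ek' r).symm

/-- A functor to torsors that lies over the inclusion of the members of `R`, up to the isomorphisms
`i`, is a descent datum. -/
def ofFunctor (F : R.arrows.category ⥤ BObj A) (i : ∀ g, g.obj.left ≅ (F.obj g).base)
    (hi : ∀ ⦃g' g : R.arrows.category⦄ (u : g' ⟶ g),
      (i g').hom ≫ BObj.Hom.base (F.map u) = u.hom.left ≫ (i g).hom) : DescentDatum A R where
  obj _ f hf := F.obj ⟨Over.mk f, hf⟩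
  iso _ f hf := i ⟨Over.mk f, hf⟩
  map _ _ _ _ _ _ g e := F.map (ObjectProperty.homMk (Over.homMk g e))
  iso_comp_base_map _ _ _ _ _ _ _ _ := hi _
  map_comp_map _ _ _ _ _ _ _ _ _ _ _ _ _ _ := (F.map_comp _ _).symm

theorem iso_hom_comp_base {hR : R ∈ J S} {Y : C} {f : Y ⟶ S} {hf : R f}
    {ε : D.obj f hf ⟶ D.glue hR} (hε : BObj.Hom.base ε = (D.iso f hf).inv ≫ f) :
    (D.iso f hf).hom ≫ BObj.Hom.base ε = f :=
  (congrArg (_ ≫ ·) hε).trans (Iso.hom_inv_id_assoc _ _)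

theorem exists_sec_glue {n : ℕ} (hR : R ∈ J S)
    {ε : ∀ ⦃Y : C⦄ (f : Y ⟶ S) (hf : R f), D.obj f hf ⟶ D.glue hR}
    (hb : ∀ ⦃Y : C⦄ (f : Y ⟶ S) (hf : R f), BObj.Hom.base (ε f hf) = (D.iso f hf).inv ≫ f)
    (hε : ∀ ⦃Y Z : C⦄ {f : Y ⟶ S} {f' : Z ⟶ S} (hf : R f) (hf' : R f') (g : Z ⟶ Y)
      (e : g ≫ f = f'), D.map hf hf' g e ≫ ε f hf = ε f' hf')
    (τ : ∀ ⦃Y : C⦄ (f : Y ⟶ S) (hf : R f),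
      SecAt ((D.obj f hf).torsor.power n) (D.iso f hf).hom)
    (hτ : ∀ ⦃Y Z : C⦄ {f : Y ⟶ S} {f' : Z ⟶ S} (hf : R f) (hf' : R f') (g : Z ⟶ Y)
      (e : g ≫ f = f'), powOn (D.map hf hf' g e) n (D.iso_comp_base_map hf hf' g e) (τ f' hf') =
        SecAt.res g rfl (τ f hf)) :
    ∃ s : SecAt ((D.glue hR).torsor.power n) (𝟙 S), ∀ ⦃Y : C⦄ (f : Y ⟶ S) (hf : R f),
      powOn (ε f hf) n (iso_hom_comp_base (hb f hf)) (τ f hf) =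
        SecAt.res f (Category.comp_id f) s := by
  have compat ⦃Y Z : C⦄ {f : Y ⟶ S} {f' : Z ⟶ S} (hf : R f) (hf' : R f') (g : Z ⟶ Y)
      (e : g ≫ f = f') : SecAt.res g e (powOn (ε f hf) n (iso_hom_comp_base (hb f hf)) (τ f hf)) =
        powOn (ε f' hf') n (iso_hom_comp_base (hb f' hf')) (τ f' hf') := by
    have em : (g ≫ (D.iso f hf).hom) ≫ BObj.Hom.base (ε f hf) = f' :=
      (Category.assoc ..).trans ((congrArg (g ≫ ·) (iso_hom_comp_base (hb f hf))).trans e)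
    have powOn_ε {θ} (hθ : D.map hf hf' g e ≫ ε f hf = θ)
        (eθ : (D.iso f' hf').hom ≫ BObj.Hom.base θ = f') : powOn θ n eθ (τ f' hf') =
          powOn (ε f hf) n em
            (powOn (D.map hf hf' g e) n (D.iso_comp_base_map hf hf' g e) (τ f' hf')) := by
      subst hθ
      exact powOn_comp ..
    rw [powOn_ε (hε hf hf' g e), hτ]
    exact (powOn_res _ _ g rfl em _).symm
  obtain ⟨s, hs⟩ := SecAt.glue (F := (D.glue hR).torsor.power n) (f := 𝟙 S)
    (fun Z g f' _ t => ∃ hf : R f', t = powOn (ε f' hf) n (iso_hom_comp_base (hb f' hf)) (τ f' hf))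
    (fun Z W g k f' f'' _ e' _ s ⟨hf, hs⟩ =>
      have hf'' : R f'' := e' ▸ R.downward_closed hf k
      ⟨hf'', hs ▸ compat hf hf'' k e'⟩)
    (fun Z g f' _ s t ⟨_, hs⟩ ⟨_, ht⟩ => hs.trans ht.symm)
    hR (fun Z g f' e hg => ⟨_, (Category.comp_id g).symm.trans e ▸ hg, rfl⟩)
  exact ⟨s, fun Y f hf => (hs f _ _ ⟨hf, rfl⟩).symm⟩

end DescentDatum

end Descent

theorem eqToHom_comp_map_basedFunctor {𝒳 𝒴 : BasedCategory C} (D : BasedFunctor 𝒳 𝒴) {a b : 𝒳.obj}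
    (u : a ⟶ b) : eqToHom (D.w_obj a).symm ≫ 𝒴.p.map (D.map u) =
      𝒳.p.map u ≫ eqToHom (D.w_obj b).symm := by
  have map_eq : 𝒴.p.map (D.map u) = _ := Functor.congr_hom D.w u
  rw [map_eq, eqToHom_trans_assoc, eqToHom_refl, Category.id_comp]

theorem isStack_classifyingStack (A : Sheaf J AddCommGrpCat.{max u v}) :
    IsStack J (classifyingStack A) where
  isFibered := isFibered_of_existsUnique_lift (p := BObj.proj A)
    (fun _ _ _ φ ψ b hb => BObj.Hom.existsUnique_lift φ ψ b hb)
    (fun a _ f => ⟨BObj.pull a f, BObj.pullHom a f, IsHomLift.map (BObj.proj A) (BObj.pullHom a f)⟩)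
  isIso_of_isHomLift_id S _ _ φ hφ := isIso_of_isHomLift_id (p := BObj.proj A)
    (fun _ _ _ φ ψ b hb => BObj.Hom.existsUnique_lift φ ψ b hb) (S := S) φ hφ
  glue_hom _ _ _ _ hR _ hbase hψ := BObj.existsUnique_glue_hom hbase hψ hR
  effective_descent S R hR D := by
    let D' := DescentDatum.ofFunctor (A := A) D.toFunctor (fun g => eqToIso (D.w_obj g).symm)
      (fun _ _ u => eqToHom_comp_map_basedFunctor D u)
    obtain ⟨ε, hb, hε⟩ := D'.exists_compatible_hom_glue hR
    refine ⟨D'.glue hR, fun g => ε g.obj.hom g.property, rfl, fun g => ?_,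
      fun g g' u => hε g'.property g.property u.hom.left (Over.w u.hom)⟩
    refine IsHomLift.of_fac' (BObj.proj A) _ _ (D.w_obj g) rfl ?_
    exact (hb _ _).trans (congrArg (_ ≫ ·) (Category.comp_id g.obj.hom).symm)

namespace BPowObj

variable {A : Sheaf J AddCommGrpCat.{max u v}} {n : ℕ} {P Q R : BPowObj A n}

open BObj.Hom

/-- The functor `B_n A → B A` that forgets the section of the power. -/
def forgetSec (A : Sheaf J AddCommGrpCat.{max u v}) (n : ℕ) : BPowObj A n ⥤ BObj A where
  obj P := P.toBObj
  map φ := Hom.hom φ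

theorem PreservesSec.of_comp {φ : P.toBObj ⟶ Q.toBObj} {χ : R.toBObj ⟶ P.toBObj}
    (hφ : PreservesSec φ) (h : PreservesSec (P := R) (Q := Q) (χ ≫ φ)) : PreservesSec χ := by
  refine (preservesSec_iff χ).2 fun Y f f' e =>
    powOn_injective φ (f' := f' ≫ BObj.Hom.base φ) rfl ?_
  have e' : f ≫ BObj.Hom.base (χ ≫ φ) = f' ≫ BObj.Hom.base φ :=
    (Category.assoc ..).symm.trans (congrArg (· ≫ _) e)
  rw [← powOn_comp χ φ e rfl e', (preservesSec_iff φ).1 hφ]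
  exact (preservesSec_iff (P := R) (Q := Q) (χ ≫ φ)).1 h f _ e'

theorem preservesSec_of_iso {φ : P.toBObj ⟶ Q.toBObj} {Y : C} (i : Y ≅ P.base) {f : Y ⟶ Q.base}
    (e : i.hom ≫ BObj.Hom.base φ = f) (h : powOn φ n e (P.secAt i.hom) = Q.secAt f) :
    PreservesSec φ := by
  refine (preservesSec_iff φ).2 fun Z g g' e' => ?_
  rw [← res_secAt P i.hom (f' := g) (g ≫ i.inv) (by simp), powOn_res φ e, h]
  exact res_secAt ..

theorem exists_preservesSec {P : BObj A} (φ : P ⟶ Q.toBObj) :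
    ∃ s, PreservesSec (P := ⟨P, s⟩) (Q := Q) φ := by
  obtain ⟨s, hs⟩ := (powOn_bijective (n := n) (f := 𝟙 P.base) φ rfl).2
    (Q.secAt (𝟙 P.base ≫ BObj.Hom.base φ))
  refine ⟨s, (preservesSec_iff (P := ⟨P, s⟩) φ).2 fun Y f f' e => ?_⟩
  refine (powOn_res φ rfl f (Category.comp_id f) e s).trans ?_
  rw [hs, res_secAt]

theorem existsUnique_lift (φ : P ⟶ Q) (ψ : R ⟶ Q) (b : R.base ⟶ P.base)
    (hb : b ≫ BObj.Hom.base (Hom.hom φ) = BObj.Hom.base (Hom.hom ψ)) :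
    ∃! χ : R ⟶ P, BObj.Hom.base (Hom.hom χ) = b ∧ χ ≫ φ = ψ := by
  obtain ⟨χ, ⟨hbase, hcomp⟩, huniq⟩ := BObj.Hom.existsUnique_lift (Hom.hom φ) (Hom.hom ψ) b hb
  have hχ : PreservesSec χ := .of_comp (Hom.preservesSec φ) (hcomp ▸ Hom.preservesSec ψ)
  exact ⟨⟨χ, hχ⟩, ⟨hbase, Hom.ext hcomp⟩, fun χ' h =>
    Hom.ext (huniq _ ⟨h.1, congrArg Hom.hom h.2⟩)⟩

section Glue

variable {b : P.base ⟶ Q.base} {R : Sieve P.base}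
  {ψ : ∀ ⦃c : BPowObj A n⦄ (φ : c ⟶ P), R (BObj.Hom.base (Hom.hom φ)) → (c ⟶ Q)}
  (hbase : ∀ ⦃c : BPowObj A n⦄ (φ : c ⟶ P) (h : R (BObj.Hom.base (Hom.hom φ))),
    BObj.Hom.base (Hom.hom (ψ φ h)) = BObj.Hom.base (Hom.hom φ) ≫ b)
  (hψ : ∀ ⦃c c' : BPowObj A n⦄ (χ : c' ⟶ c) (φ : c ⟶ P) (h : R (BObj.Hom.base (Hom.hom φ)))
    (h' : R (BObj.Hom.base (Hom.hom (χ ≫ φ)))), ψ (χ ≫ φ) h' = χ ≫ ψ φ h)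
  (hR : R ∈ J P.base)

include hR

theorem preservesSec_of_forall_comp {θ : P.toBObj ⟶ Q.toBObj}
    (h : ∀ ⦃c : BPowObj A n⦄ (φ : c ⟶ P), R (BObj.Hom.base (Hom.hom φ)) →
      PreservesSec (P := c) (Q := Q) (Hom.hom φ ≫ θ)) : PreservesSec θ := by
  refine preservesSec_of_cover hR fun Y f f' e hf => ?_
  obtain ⟨c, φ, i, rfl⟩ := P.toBObj.exists_pull f
  obtain ⟨s, hs⟩ := exists_preservesSec (Q := P) φ
  have e' : i.hom ≫ BObj.Hom.base (φ ≫ θ) = f' := (Category.assoc ..).symm.trans e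
  have hφ : R (BObj.Hom.base φ) := by simpa using R.downward_closed hf i.inv
  rw [← (preservesSec_iff (P := ⟨c, s⟩) φ).1 hs i.hom _ rfl, ← powOn_comp φ θ rfl e e']
  exact (preservesSec_iff _).1 (h (c := ⟨c, s⟩) ⟨φ, hs⟩ hφ) _ _ e'

include hbase hψ

theorem existsUnique_glue_hom : ∃! θ : P ⟶ Q, BObj.Hom.base (Hom.hom θ) = b ∧
    ∀ ⦃c : BPowObj A n⦄ (φ : c ⟶ P) (h : R (BObj.Hom.base (Hom.hom φ))), φ ≫ θ = ψ φ h := by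
  choose s hs using fun (c : BObj A) (φ : c ⟶ P.toBObj) => exists_preservesSec (Q := P) φ
  let lift ⦃c : BObj A⦄ (φ : c ⟶ P.toBObj) : (⟨c, s c φ⟩ : BPowObj A n) ⟶ P := ⟨φ, hs c φ⟩
  obtain ⟨θ, ⟨hθb, hθ⟩, huniq⟩ := BObj.existsUnique_glue_hom
    (ψ := fun c φ h => Hom.hom (ψ (lift φ) h)) (fun c φ h => hbase (lift φ) h)
    (fun c c' χ φ h h' => congrArg Hom.hom (hψ (c := ⟨c, s c φ⟩) (c' := ⟨c', s c' (χ ≫ φ)⟩)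
      ⟨χ, .of_comp (hs c φ) (hs c' _)⟩ (lift φ) h h')) hR
  have ψ_lift ⦃c : BPowObj A n⦄ (φ : c ⟶ P) (h : R (BObj.Hom.base (Hom.hom φ))) :
      Hom.hom (ψ (lift (Hom.hom φ)) h) = Hom.hom (ψ φ h) := by
    have hid := Category.id_comp (Hom.hom φ)
    let χ : (⟨c.toBObj, s c.toBObj (Hom.hom φ)⟩ : BPowObj A n) ⟶ c :=
      ⟨𝟙 c.toBObj, .of_comp (Hom.preservesSec φ) (hid.symm ▸ hs _ _)⟩
    have χ_comp : χ ≫ φ = lift (Hom.hom φ) := Hom.ext hid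
    have := hψ χ φ h (χ_comp ▸ h)
    simp only [χ_comp] at this
    rw [this]
    exact Category.id_comp (Hom.hom (ψ φ h))
  have comp_θ ⦃c : BPowObj A n⦄ (φ : c ⟶ P) (h : R (BObj.Hom.base (Hom.hom φ))) :
      Hom.hom φ ≫ θ = Hom.hom (ψ φ h) := (hθ _ h).trans (ψ_lift φ h)
  exact ⟨⟨θ, preservesSec_of_forall_comp hR fun c φ h => comp_θ φ h ▸ Hom.preservesSec _⟩,
    ⟨hθb, fun c φ h => Hom.ext (comp_θ φ h)⟩, fun θ' ⟨hθ'b, hθ'⟩ =>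
    Hom.ext (huniq _ ⟨hθ'b, fun c φ h => congrArg Hom.hom (hθ' (lift φ) h)⟩)⟩

end Glue

end BPowObj

namespace DescentDatum

open BObj.Hom BPowObj

variable {A : Sheaf J AddCommGrpCat.{max u v}} {n : ℕ} {S : C} {R : Sieve S}

theorem exists_compatible_preservesSec (D : DescentDatum A R) (hR : R ∈ J S)
    (σ : ∀ ⦃Y : C⦄ (f : Y ⟶ S) (hf : R f),
      ((D.obj f hf).torsor.power n).obj.obj (op (Over.mk (𝟙 (D.obj f hf).base))))
    (hσ : ∀ ⦃Y Z : C⦄ {f : Y ⟶ S} {f' : Z ⟶ S} (hf : R f) (hf' : R f') (g : Z ⟶ Y)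
      (e : g ≫ f = f'), PreservesSec (P := ⟨D.obj f' hf', σ f' hf'⟩)
        (Q := ⟨D.obj f hf, σ f hf⟩) (D.map hf hf' g e)) :
    ∃ (s : ((D.glue hR).torsor.power n).obj.obj (op (Over.mk (𝟙 S))))
      (ε : ∀ ⦃Y : C⦄ (f : Y ⟶ S) (hf : R f), D.obj f hf ⟶ D.glue hR),
      (∀ ⦃Y : C⦄ (f : Y ⟶ S) (hf : R f), PreservesSec (P := ⟨D.obj f hf, σ f hf⟩)
        (Q := ⟨D.glue hR, s⟩) (ε f hf)) ∧
      (∀ ⦃Y : C⦄ (f : Y ⟶ S) (hf : R f), BObj.Hom.base (ε f hf) = (D.iso f hf).inv ≫ f) ∧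
      ∀ ⦃Y Z : C⦄ {f : Y ⟶ S} {f' : Z ⟶ S} (hf : R f) (hf' : R f') (g : Z ⟶ Y) (e : g ≫ f = f'),
        D.map hf hf' g e ≫ ε f hf = ε f' hf' := by
  obtain ⟨ε, hb, hε⟩ := D.exists_compatible_hom_glue hR
  obtain ⟨s, hs⟩ := exists_sec_glue (n := n) hR hb hε
    (fun Y f hf => BPowObj.secAt ⟨D.obj f hf, σ f hf⟩ (D.iso f hf).hom)
    (fun Y Z f f' hf hf' g e => ((preservesSec_iff _).1 (hσ hf hf' g e) _ _
      (D.iso_comp_base_map hf hf' g e)).trans (res_secAt _ _ g rfl).symm)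
  exact ⟨s, ε, fun Y f hf => preservesSec_of_iso (D.iso f hf) _ (hs f hf), hb, hε⟩

end DescentDatum

theorem isStack_powClassifyingStack (A : Sheaf J AddCommGrpCat.{max u v}) (n : ℕ) :
    IsStack J (powClassifyingStack A n) where
  isFibered := isFibered_of_existsUnique_lift (p := BPowObj.proj A n)
    (fun _ _ _ φ ψ b hb => BPowObj.existsUnique_lift φ ψ b hb)
    (fun a _ f => by
      obtain ⟨s, hs⟩ := BPowObj.exists_preservesSec (Q := a) (BObj.pullHom a.toBObj f)
      let φ : (⟨BObj.pull a.toBObj f, s⟩ : BPowObj A n) ⟶ a := ⟨BObj.pullHom a.toBObj f, hs⟩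
      exact ⟨_, φ, IsHomLift.map (BPowObj.proj A n) φ⟩)
  isIso_of_isHomLift_id S _ _ φ hφ := isIso_of_isHomLift_id (p := BPowObj.proj A n)
    (fun _ _ _ φ ψ b hb => BPowObj.existsUnique_lift φ ψ b hb) (S := S) φ hφ
  glue_hom _ _ _ _ hR _ hbase hψ := BPowObj.existsUnique_glue_hom hbase hψ hR
  effective_descent S R hR D := by
    let D' := DescentDatum.ofFunctor (D.toFunctor ⋙ BPowObj.forgetSec A n)
      (fun g => eqToIso (D.w_obj g).symm) (fun _ _ u => eqToHom_comp_map_basedFunctor D u)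
    obtain ⟨s, ε, hs, hb, hε⟩ := D'.exists_compatible_preservesSec (n := n) hR
      (fun _ f hf => BPowObj.sec (D.obj ⟨Over.mk f, hf⟩))
      (fun Y Z f f' hf hf' g e =>
        let u : (⟨Over.mk f', hf'⟩ : R.arrows.category) ⟶ ⟨Over.mk f, hf⟩ :=
          ObjectProperty.homMk (Over.homMk g e)
        BPowObj.Hom.preservesSec (D.map u))
    refine ⟨(⟨D'.glue hR, s⟩ : BPowObj A n), fun g => ⟨ε g.obj.hom g.property, hs _ _⟩, rfl,
      fun g => ?_, fun g g' u =>
        BPowObj.Hom.ext (hε g'.property g.property u.hom.left (Over.w u.hom))⟩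
    refine IsHomLift.of_fac' (BPowObj.proj A n) _ _ (D.w_obj g) rfl ?_
    exact (hb _ _).trans (congrArg (_ ≫ ·) (Category.comp_id g.obj.hom).symm)

section Equivalence

variable {𝒳 𝒴 : BasedCategory.{v', u'} C}

theorem isEquivalenceOver_of_full_of_faithful (F : BasedFunctor 𝒳 𝒴) [F.Full] [F.Faithful]
    (hF : ∀ b : 𝒴.obj, ∃ (a : 𝒳.obj) (e : F.obj a ≅ b), 𝒴.p.IsHomLift (𝟙 (𝒴.p.obj b)) e.hom) :
    IsEquivalenceOver F := by
  choose a e he using hF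
  let G₀ : 𝒴.obj ⥤ 𝒳.obj :=
    { obj := a
      map := fun {b c} φ => F.preimage ((e b).hom ≫ φ ≫ (e c).inv)
      map_id := fun b => F.map_injective (by simp)
      map_comp := fun φ ψ => F.map_injective (by simp) }
  have isHomLift_map {b c : 𝒴.obj} (φ : b ⟶ c) : 𝒳.p.IsHomLift (𝒴.p.map φ) (G₀.map φ) := by
    have : 𝒴.p.IsHomLift (𝒴.p.map φ) (F.map (G₀.map φ)) := by
      rw [F.map_preimage]
      infer_instance
    exact F.isHomLift_map _ _
  let G : BasedFunctor 𝒴 𝒳 :=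
    { toFunctor := G₀
      w := CategoryTheory.Functor.ext
        (fun b => IsHomLift.domain_eq 𝒳.p (𝒴.p.map (𝟙 b)) (G₀.map (𝟙 b)))
        fun b c φ => IsHomLift.fac' 𝒳.p (𝒴.p.map φ) (G₀.map φ) }
  let η : G.toFunctor ⋙ F.toFunctor ≅ 𝟭 𝒴.obj :=
    NatIso.ofComponents e fun φ => by simp [G, G₀]
  let ε : F.toFunctor ⋙ G.toFunctor ≅ 𝟭 𝒳.obj :=
    NatIso.ofComponents (fun b => F.preimageIso (e (F.obj b)))
      fun φ => F.map_injective (by simp [G, G₀])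
  refine ⟨G, ⟨BasedNatIso.mkNatIso ε fun b => ?_⟩, ⟨BasedNatIso.mkNatIso η he⟩⟩
  rw [← F.isHomLift_iff, ← F.w_obj]
  exact (F.map_preimage (e (F.obj b)).hom).symm ▸ he (F.obj b)

end Equivalence

section Contraction

variable {A H : Sheaf J AddCommGrpCat.{max u v}} (i : H ⟶ A)

namespace Torsor

variable {S : C} {T : Torsor H S}

variable (T) in
/-- The class of `(0, t)` in the contraction product of `A` and `T`, for a section `t` of `T`. -/
noncomputable def contractOn {Y : C} {f : Y ⟶ S} (t : SecAt T.sheaf f) :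
    SecAt (contract i T).sheaf f :=
  contractMk i T (X := Over.mk f) 0 t

theorem res_contractOn {Y Z : C} {f : Y ⟶ S} {f' : Z ⟶ S} (g : Z ⟶ Y) (e : g ≫ f = f')
    (t : SecAt T.sheaf f) :
    SecAt.res g e (T.contractOn i t) = T.contractOn i (SecAt.res g e t) := by
  refine (contractMk_map i T (Over.homMk (U := Over.mk f') (V := Over.mk f) g e) 0 t).trans ?_
  rw [map_zero]
  rfl

theorem contractOn_vadd {Y : C} {f : Y ⟶ S} (h : Grp H Y) (t : SecAt T.sheaf f) :
    T.contractOn i (h +ᵥ t) = grpMap i h +ᵥ T.contractOn i t :=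
  contractMk_zero_vadd i T (X := Over.mk f) h t

theorem contractOn_injective (hi : ∀ Y, Function.Injective (grpMap i (U := Y))) {Y : C}
    {f : Y ⟶ S} : Function.Injective (T.contractOn i (f := f)) := fun s t h => by
  obtain ⟨a, rfl⟩ := secAt_exists_vadd_eq s t
  rw [contractOn_vadd] at h
  have ha : grpMap i a = grpMap i 0 :=
    (secAt_vadd_cancel ((zero_vadd (Grp A Y) _).trans h)).symm.trans (map_zero _).symm
  rw [hi Y ha, zero_vadd]

end Torsor

namespace BObj

open TorsorStack.Torsor

variable {P Q : BObj H} {B : BObj A}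

theorem on_inducedMap_contractOn (φ : P ⟶ Q) {Y : C} {f : Y ⟶ P.base} {f' : Y ⟶ Q.base}
    (e : f ≫ Hom.base φ = f')
    (e' : f ≫ Hom.base (P := inducedObj i P) (Q := inducedObj i Q) (inducedMap i φ) = f')
    (t : SecAt P.torsor.sheaf f) :
    Hom.on (inducedMap i φ) e' (P.torsor.contractOn i t) =
      Q.torsor.contractOn i (Hom.on φ e t) := by
  subst e
  refine (Hom.on_rfl (inducedMap i φ) _).trans ((inducedMap_app_mk i φ t).trans ?_)
  rw [Hom.on_rfl]
  rfl

theorem exists_hom_on_contractOn_eq (b : P.base ⟶ B.base)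
    (l : ∀ ⦃Y : C⦄ (f : Y ⟶ P.base) (f' : Y ⟶ B.base), f ≫ b = f' →
      SecAt P.torsor.sheaf f → SecAt B.torsor.sheaf f')
    (l_res : ∀ ⦃Y Z : C⦄ (f : Y ⟶ P.base) (f' : Y ⟶ B.base) (e : f ≫ b = f') (k : Z ⟶ P.base)
      (k' : Z ⟶ B.base) (e' : k ≫ b = k') (g : Z ⟶ Y) (eg : g ≫ f = k) (eg' : g ≫ f' = k')
      (s : SecAt P.torsor.sheaf f),
      l k k' e' (SecAt.res g eg s) = SecAt.res g eg' (l f f' e s))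
    (l_vadd : ∀ ⦃Y : C⦄ (f : Y ⟶ P.base) (f' : Y ⟶ B.base) (e : f ≫ b = f') (a : Grp H Y)
      (s : SecAt P.torsor.sheaf f), l f f' e (a +ᵥ s) = grpMap i a +ᵥ l f f' e s) :
    ∃ φ : inducedObj i P ⟶ B, Hom.base φ = b ∧
      ∀ ⦃Y : C⦄ (f : Y ⟶ P.base) (f' : Y ⟶ B.base) (e : f ≫ b = f')
        (e' : f ≫ Hom.base (P := inducedObj i P) φ = f') (s : SecAt P.torsor.sheaf f),
          Hom.on φ e' (P.torsor.contractOn i s) = l f f' e s := by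
  refine ⟨lift i b (fun X t => l X.hom _ rfl t)
    (fun X Y g t => l_res X.hom _ rfl Y.hom _ rfl g.left (Over.w g)
      (Over.w ((Over.map b).map g)) t)
    (fun X h t => l_vadd X.hom _ rfl h t), rfl, fun Y f f' e e' s => ?_⟩
  subst e
  exact (Hom.on_rfl _ _).trans (lift_app_mk i b _ _ _ (X := Over.mk f) s)

theorem ext_on_contractOn {φ ψ : inducedObj i P ⟶ B} (hb : Hom.base φ = Hom.base ψ)
    (h : ∀ ⦃Y : C⦄ (f : Y ⟶ P.base) (f' : Y ⟶ B.base)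
      (e : f ≫ Hom.base (P := inducedObj i P) φ = f')
      (e' : f ≫ Hom.base (P := inducedObj i P) ψ = f') (s : SecAt P.torsor.sheaf f),
        Hom.on φ e (P.torsor.contractOn i s) = Hom.on ψ e' (P.torsor.contractOn i s)) :
    φ = ψ := by
  refine induced_hom_ext i hb fun X t e he => ?_
  have app_eq := (Hom.on_rfl φ (f := X.hom) _).symm.trans (h X.hom _ rfl (by rw [hb]) t)
  refine Eq.trans ?_ app_eq.symm
  refine congrArg (fun g => B.torsor.sheaf.obj.map (Quiver.Hom.op g) (Hom.app ψ X _)) ?_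
  ext
  exact he

end BObj

end Contraction

section Roots

namespace BPowObj

open TorsorStack.Torsor

variable {A : Sheaf J AddCommGrpCat.{max u v}} {n : ℕ} {P : BPowObj A n} {Y Z : C}
  {f : Y ⟶ P.base} {t s : SecAt P.torsor.sheaf f}

variable (P) in
/-- A section `t` of the torsor is a root of the given section of the `n`-th power if the latter
is the class of `(t, …, t)`. -/
def IsRoot {Y : C} {f : Y ⟶ P.base} (t : SecAt P.torsor.sheaf f) : Prop :=
  P.torsor.powMk n (fun _ => t) = P.secAt f

theorem IsRoot.res (h : P.IsRoot t) (g : Z ⟶ Y) {f' : Z ⟶ P.base} (e : g ≫ f = f') :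
    P.IsRoot (SecAt.res g e t) := by
  have h' := congrArg (SecAt.res g e) h
  rwa [res_powMk, res_secAt] at h'

theorem isRoot_of_cover {R : Sieve Y} (hR : R ∈ J Y)
    (h : ∀ ⦃Z : C⦄ (g : Z ⟶ Y), R g → P.IsRoot (SecAt.res g rfl t)) : P.IsRoot t :=
  SecAt.ext hR fun Z g f' e hg => by
    subst e
    rw [res_powMk, res_secAt]
    exact h g hg

theorem IsRoot.vadd_iff (h : P.IsRoot t) {a : Grp A Y} : P.IsRoot (a +ᵥ t) ↔ n • a = 0 := by
  rw [IsRoot, ← h, powMk_vadd_eq_iff (a := fun _ => a), Fin.sum_const]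

theorem IsRoot.exists_vadd_eq (h : P.IsRoot t) (h' : P.IsRoot s) :
    ∃ a : Grp A Y, n • a = 0 ∧ a +ᵥ t = s := by
  obtain ⟨a, rfl⟩ := secAt_exists_vadd_eq t s
  exact ⟨a, h.vadd_iff.1 h', rfl⟩

theorem IsRoot.on {Q : BPowObj A n} (h : P.IsRoot t) (φ : P ⟶ Q) {f' : Y ⟶ Q.base}
    (e : f ≫ BObj.Hom.base (Hom.hom φ) = f') : Q.IsRoot (BObj.Hom.on (Hom.hom φ) e t) := by
  have h' := congrArg (BObj.Hom.powOn (Hom.hom φ) n e) h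
  rwa [BObj.Hom.powOn_powMk, (preservesSec_iff _).1 (Hom.preservesSec φ) f f' e] at h'

theorem isRoot_vadd_of_nsmul_eq_sum {x : Fin n → SecAt P.torsor.sheaf f}
    (hx : P.secAt f = P.torsor.powMk n x) {a : Fin n → Grp A Y} (ha : ∀ j, a j +ᵥ t = x j)
    {b : Grp A Y} (hb : n • b = ∑ j, a j) : P.IsRoot (b +ᵥ t) := by
  have vadd_eq (j : Fin n) : (a j - b) +ᵥ b +ᵥ t = x j := by
    rw [vadd_vadd, sub_add_cancel, ha]
  rw [IsRoot, hx, ← funext vadd_eq]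
  refine (powMk_vadd_eq_iff (a := fun j => a j - b) (x := fun _ => b +ᵥ t)).2 ?_ |>.symm
  rw [Finset.sum_sub_distrib, ← hb, Fin.sum_const, sub_self]

theorem exists_cover_isRoot (hn : 0 < n) (hA : Sheaf.IsLocallySurjective (mulBy A n))
    (f : Y ⟶ P.base) : ∃ R ∈ J Y, ∀ ⦃Z : C⦄ (g : Z ⟶ Y) {f' : Z ⟶ P.base}, g ≫ f = f' → R g →
      ∃ t : SecAt P.torsor.sheaf f', P.IsRoot t := by
  obtain ⟨R, hR, h⟩ := exists_cover_powMk (P.secAt f)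
  let K : Sieve Y :=
    { arrows := fun Z g => ∃ t : SecAt P.torsor.sheaf (g ≫ f), P.IsRoot t
      downward_closed := fun ⟨_, ht⟩ k => ⟨_, ht.res k (Category.assoc k _ f).symm⟩ }
  refine ⟨K, J.transitive hR K fun Z g hg => ?_, fun Z g f' e hg => by subst e; exact hg⟩
  obtain ⟨x, hx⟩ := h g rfl hg
  rw [res_secAt] at hx
  choose a ha using fun j => secAt_exists_vadd_eq (x ⟨0, hn⟩) (x j)
  refine J.superset_covering (fun W k hk => ?_) (hA.imageSieve_mem (U := Z) (∑ j, a j))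
  obtain ⟨b, hb⟩ : ∃ b : Grp A W, n • b = A.obj.map k.op (∑ j, a j) := hk
  have e : (k ≫ g) ≫ f = k ≫ g ≫ f := Category.assoc k g f
  refine ⟨b +ᵥ SecAt.res k e.symm (x ⟨0, hn⟩), isRoot_vadd_of_nsmul_eq_sum
    (x := fun j => SecAt.res k e.symm (x j)) (a := fun j => A.obj.map k.op (a j)) ?_
    (fun j => ?_) (hb.trans (map_sum _ _ _))⟩
  · rw [← res_powMk, ← hx, res_secAt]
  · rw [← ha j, res_vadd]

variable (P)

/-- The presheaf of roots on `Over P.base`. -/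
def rootSubfunctor : Subfunctor P.torsor.sheaf.obj where
  obj X := {t | P.IsRoot (f := X.unop.hom) t}
  map g _ ht := IsRoot.res ht g.unop.left (Over.w g.unop)

theorem isSheaf_rootSubfunctor : Presheaf.IsSheaf (J.over P.base) P.rootSubfunctor.toFunctor := by
  rw [isSheaf_iff_isSheaf_of_type,
    Subfunctor.isSheaf_iff _ ((isSheaf_iff_isSheaf_of_type _ _).1 P.torsor.sheaf.property)]
  intro X t ht
  refine isRoot_of_cover ((J.mem_over_iff _).1 ht) fun Z g hg => ?_
  exact (Sieve.overEquiv_iff _ g).1 hg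

variable (hn : 0 < n) (hA : Sheaf.IsLocallySurjective (mulBy A n))

/-- The torsor of roots under the `n`-torsion of `A`. -/
def rootTorsor : Torsor (torsion A n) P.base where
  sheaf := ⟨P.rootSubfunctor.toFunctor, P.isSheaf_rootSubfunctor⟩
  act X :=
    { vadd := fun a t => ⟨a.1 +ᵥ t.1, (IsRoot.vadd_iff t.2).2 a.2⟩
      zero_vadd := fun t => Subtype.ext (zero_vadd (Grp A X.left) t.1)
      add_vadd := fun a b t => Subtype.ext (add_vadd a.1 b.1 t.1) }
  map_vadd X Y g a t := Subtype.ext (res_vadd g.left (Over.w g) a.1 t.1)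
  simply_transitive X := by
    constructor
    · rintro ⟨a, t⟩ ⟨b, s⟩ h
      obtain ⟨rfl, h'⟩ := Prod.mk.inj h
      exact Prod.ext (Subtype.ext (secAt_vadd_cancel (congrArg Subtype.val h'))) rfl
    · rintro ⟨t, s⟩
      obtain ⟨a, ha, h⟩ := IsRoot.exists_vadd_eq t.2 s.2
      exact ⟨(⟨a, ha⟩, t), Prod.ext rfl (Subtype.ext h)⟩
  locally_nonempty X := by
    obtain ⟨R, hR, h⟩ := exists_cover_isRoot hn hA X.hom
    refine ⟨_, J.overEquiv_symm_mem_over X R hR, fun Z g hg => ?_⟩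
    obtain ⟨t, ht⟩ := h g.left (Over.w g) ((Sieve.overEquiv_symm_iff R g).1 hg)
    exact ⟨⟨t, ht⟩⟩

/-- The torsor of roots, as an object over `P.base`. -/
abbrev root : BObj (torsion A n) := ⟨P.base, P.rootTorsor hn hA⟩

variable {P hn hA}

/-- The section of the torsor of `P` underlying a section of the torsor of roots. -/
def rootVal (t : SecAt (P.rootTorsor hn hA).sheaf f) : SecAt P.torsor.sheaf f :=
  Subtype.val t

theorem isRoot_rootVal (t : SecAt (P.rootTorsor hn hA).sheaf f) : P.IsRoot (rootVal t) :=
  Subtype.property t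

theorem rootVal_res (g : Z ⟶ Y) {f' : Z ⟶ P.base} (e : g ≫ f = f')
    (t : SecAt (P.rootTorsor hn hA).sheaf f) :
    rootVal (SecAt.res g e t) = SecAt.res g e (rootVal t) :=
  rfl

theorem rootVal_vadd (a : Grp (torsion A n) Y) (t : SecAt (P.rootTorsor hn hA).sheaf f) :
    rootVal (a +ᵥ t) = grpMap (torsionIncl A n) a +ᵥ rootVal t :=
  rfl

end BPowObj

end Roots

section NaturalMap

open TorsorStack.Torsor BPowObj

variable {A : Sheaf J AddCommGrpCat.{max u v}} {n : ℕ} {P Q : BObj (torsion A n)} {Y : C}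
  {f : Y ⟶ P.base}

theorem isRoot_contractOn (t : SecAt P.torsor.sheaf f) :
    (torsionToPowObj A n P).IsRoot (P.torsor.contractOn (torsionIncl A n) t) :=
  (contractSection_map (torsionIncl A n) P.torsor n (nsmul_torsion A n)
    (X := Over.mk f) t).symm

theorem contractOn_torsionIncl_injective :
    Function.Injective (P.torsor.contractOn (torsionIncl A n) (f := f)) :=
  contractOn_injective _ fun _ => Subtype.val_injective

theorem exists_contractOn_eq {r : SecAt (contract (torsionIncl A n) P.torsor).sheaf f}
    (hr : (torsionToPowObj A n P).IsRoot r) :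
    ∃ t, P.torsor.contractOn (torsionIncl A n) t = r := by
  obtain ⟨R, hR, hne⟩ := P.torsor.exists_cover_nonempty f
  have exists_local ⦃Z : C⦄ (g : Z ⟶ Y) {f' : Z ⟶ P.base} (e : g ≫ f = f') (hg : R g) :
      ∃ t, P.torsor.contractOn (torsionIncl A n) t = SecAt.res g e r := by
    obtain ⟨s⟩ := hne g e hg
    obtain ⟨a, ha, h⟩ := IsRoot.exists_vadd_eq (isRoot_contractOn s) (hr.res g e)
    let b : Grp (torsion A n) Z := ⟨a, ha⟩
    exact ⟨b +ᵥ s, (contractOn_vadd _ b s).trans h⟩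
  obtain ⟨t, ht⟩ := SecAt.glue (F := P.torsor.sheaf) (f := f)
    (fun Z g f' e t => P.torsor.contractOn (torsionIncl A n) t = SecAt.res g e r)
    (fun Z W g k f' f'' e e' e'' t h => by
      rw [← res_contractOn, h, SecAt.res_res])
    (fun Z g f' e s t hs ht => contractOn_torsionIncl_injective (hs.trans ht.symm)) hR exists_local
  refine ⟨t, SecAt.ext hR fun Z g f' e hg => ?_⟩
  obtain ⟨s, hs⟩ := exists_local g e hg
  rw [res_contractOn, ht g e s hs, hs]

theorem torsionToPow_map_injective {φ ψ : P ⟶ Q}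
    (h : (torsionToPow A n).map φ = (torsionToPow A n).map ψ) : φ = ψ := by
  have h' : BObj.inducedMap (torsionIncl A n) φ = BObj.inducedMap (torsionIncl A n) ψ :=
    congrArg BPowObj.Hom.hom h
  have hb : BObj.Hom.base φ = BObj.Hom.base ψ :=
    congrArg (BObj.Hom.base (P := BObj.inducedObj _ P) (Q := BObj.inducedObj _ Q)) h'
  refine BObj.Hom.ext_on hb fun Y f f' e e' s => contractOn_torsionIncl_injective ?_
  refine (BObj.on_inducedMap_contractOn (torsionIncl A n) φ e e s).symm.trans
    (.trans ?_ (BObj.on_inducedMap_contractOn (torsionIncl A n) ψ e' e' s))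
  exact BObj.Hom.on_congr h' _ _ _

theorem torsionToPow_map_surjective (χ : torsionToPowObj A n P ⟶ torsionToPowObj A n Q) :
    ∃ φ, (torsionToPow A n).map φ = χ := by
  let b : P.base ⟶ Q.base := BObj.Hom.base (P := BObj.inducedObj (torsionIncl A n) P)
    (Q := BObj.inducedObj (torsionIncl A n) Q) (Hom.hom χ)
  choose l hl using fun (Y : C) (f : Y ⟶ P.base) (f' : Y ⟶ Q.base) (e : f ≫ b = f')
    (s : SecAt P.torsor.sheaf f) =>
    exists_contractOn_eq (P := Q) ((isRoot_contractOn s).on χ e)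
  obtain ⟨φ, hb, hφ⟩ := BObj.Hom.exists_hom_on_eq b l
    (fun Y Z f f' e k k' e' g eg eg' s => contractOn_torsionIncl_injective <| by
      rw [hl, ← res_contractOn, ← res_contractOn, hl]
      exact BObj.Hom.on_res _ _ _ _ _ _)
    (fun Y f f' e a s => contractOn_torsionIncl_injective <| by
      rw [hl, contractOn_vadd, contractOn_vadd, hl]
      exact BObj.Hom.on_vadd _ _ _ _)
  refine ⟨φ, BPowObj.Hom.ext (BObj.ext_on_contractOn _ hb fun Y f f' e e' s => ?_)⟩
  refine (BObj.on_inducedMap_contractOn _ φ e e s).trans ?_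
  rw [hφ f f' e' e s]
  exact hl _ _ _ _ _

variable (hn : 0 < n) (hA : Sheaf.IsLocallySurjective (mulBy A n))

theorem exists_hom_torsionToPowObj_root (P : BPowObj A n) :
    ∃ φ : torsionToPowObj A n (P.root hn hA) ⟶ P, BObj.Hom.base (Hom.hom φ) = 𝟙 P.base := by
  obtain ⟨φ, hb, hφ⟩ := BObj.exists_hom_on_contractOn_eq (P := P.root hn hA) (B := P.toBObj)
    (torsionIncl A n) (𝟙 P.base)
    (fun Y (f : Y ⟶ P.base) f' e s => SecAt.res (𝟙 Y)
      ((Category.id_comp f).trans ((Category.comp_id f).symm.trans e))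
      (rootVal (hn := hn) (hA := hA) s))
    (fun Y Z (f : Y ⟶ P.base) f' e (k : Z ⟶ P.base) k' e' g eg eg' s => by
      rw [rootVal_res, SecAt.res_res, SecAt.res_res]
      exact SecAt.res_congr ((Category.id_comp g).trans (Category.comp_id g).symm) _)
    (fun Y (f : Y ⟶ P.base) f' e a s => by
      rw [rootVal_vadd, res_vadd]
      exact congrArg (· +ᵥ _) (ConcreteCategory.congr_hom (A.obj.map_id (op Y)) _))
  obtain ⟨R, hR, hne⟩ := (P.rootTorsor hn hA).exists_cover_nonempty (𝟙 P.base)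
  refine ⟨⟨φ, preservesSec_of_cover (P := torsionToPowObj A n (P.root hn hA)) (Q := P) hR
    fun Y f f' e hf => ?_⟩, hb⟩
  obtain ⟨s⟩ := hne f (Category.comp_id f) hf
  obtain rfl : f = f' := by
    rw [hb] at e
    exact (Category.comp_id f).symm.trans e
  refine (congrArg (BObj.Hom.powOn φ n e) (isRoot_contractOn s).symm).trans ?_
  refine (BObj.Hom.powOn_powMk φ e _).trans ?_
  refine (congrArg _ (funext fun _ => hφ f f (Category.comp_id f) e s)).trans ?_
  exact (isRoot_rootVal s).res (𝟙 Y) (Category.id_comp f)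

include hn hA in
theorem isEquivalenceOver_naturalMap : IsEquivalenceOver (naturalMap A n) := by
  have : (naturalMap A n).Full := ⟨torsionToPow_map_surjective⟩
  have : (naturalMap A n).Faithful := ⟨torsionToPow_map_injective⟩
  refine isEquivalenceOver_of_full_of_faithful (naturalMap A n) fun P => ?_
  obtain ⟨φ, hb⟩ := exists_hom_torsionToPowObj_root hn hA P
  have hφ : (BPowObj.proj A n).IsHomLift (𝟙 P.base) φ :=
    IsHomLift.of_fac' (BPowObj.proj A n) _ _ rfl rfl
      (hb.trans ((Category.id_comp _).trans (Category.comp_id _)).symm)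
  have isIso_φ := (isStack_powClassifyingStack A n).isIso_of_isHomLift_id φ hφ
  exact ⟨P.root hn hA, @asIso _ _ _ _ φ isIso_φ, hφ⟩

end NaturalMap

end TorsorStack

theorem mainTheorem5 {C : Type u} [Category.{v} C] (J : GrothendieckTopology C)
    (A : Sheaf J AddCommGrpCat.{max u v}) (n : ℕ) (hn : 0 < n)
    (hA : Sheaf.IsLocallySurjective (TorsorStack.mulBy A n)) :
    TorsorStack.IsStack J (TorsorStack.classifyingStack (TorsorStack.torsion A n)) ∧
      TorsorStack.IsStack J (TorsorStack.powClassifyingStack A n) ∧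
        TorsorStack.IsEquivalenceOver (TorsorStack.naturalMap A n) :=
  ⟨TorsorStack.isStack_classifyingStack _, TorsorStack.isStack_powClassifyingStack A n,
    TorsorStack.isEquivalenceOver_naturalMap hn hA⟩
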